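/- Let $M$ be an abelian monoid, written additively, with algebraic preordering $x\le y$ iff $x+z=y$ for some $z\in M$. For an abelian group $G$, let $G\sqcup\{0\}$ be the monoid obtained from $G$ by adjoining a new neutral element $0$. For an idempotent $e=2e$ of $M$, let $G_M[e]=\{x\in M : e\le x\le e\}$; this is an abelian group under the addition of $M$, with neutral element $e$. For idempotents $a\le b$, let $j_{a,b}\colon G_M[a]\to G_M[b]$, $x\mapsto x+b$, be the natural group homomorphism. Then $M$ is isomorphic to a direct limit (over a nonempty directed partially ordered set) of finite direct sums of monoids of the form $(\mathbb{Z}/n\mathbb{Z})\sqcup\{0\}$ with $n$ a positive integer, or $\mathbb{Z}\sqcup\{0\}$, if and only if all of the following conditions hold: - $M$ is regular: $2x\le x$ for all $x\in M$; - $M$ is conical: $x+y=0$ implies $x=y=0$, for all $x,y\in M$; - $M$ is a refinement monoid: whenever $a_0+a_1=b_0+b_1$ in $M$, there are $c_{i,j}\in M$ ($i,j\in\{0,1\}$) such that $a_i=c_{i,0}+c_{i,1}$ and $b_i=c_{0,i}+c_{1,i}$ for $i=0,1$; - (emb): $j_{a,b}$ is injective for all idempotents $a\le b$ of $M$; - (pur):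 the range of $j_{a,b}$ is a pure subgroup of $G_M[b]$ for all idempotents $a\le b$ of $M$. Here a subgroup $H$ of an abelian group $G$ is pure if $H\cap nG=nH$ for every positive integer $n$. -/

import Mathlib

/-! Commutative monoids are written additively, and `WithZero G` is the monoid `G ⊔ {0}`
obtained from the abelian group `G` by adjoining a new neutral element. -/

namespace RegMon

universe u

section Order

variable {M : Type u} [AddCommMonoid M]

/-- The algebraic preordering of a commutative monoid. -/
def AlgLE (x y : M) : Prop := ∃ z : M, x + z = y

theorem AlgLE.refl (x : M) : AlgLE x x := ⟨0, add_zero x⟩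

theorem AlgLE.trans {x y z : M} (h : AlgLE x y) (h' : AlgLE y z) : AlgLE x z := by
  obtain ⟨a, rfl⟩ := h
  obtain ⟨b, rfl⟩ := h'
  exact ⟨a + b, (add_assoc x a b).symm⟩

theorem AlgLE.add {x y x' y' : M} (h : AlgLE x y) (h' : AlgLE x' y') :
    AlgLE (x + x') (y + y') := by
  obtain ⟨a, rfl⟩ := h
  obtain ⟨b, rfl⟩ := h'
  exact ⟨a + b, add_add_add_comm x x' a b⟩

/-- An element above an idempotent absorbs it. -/
theorem AlgLE.add_eq {e x : M} (he : e + e = e) (h : AlgLE e x) : e + x = x := by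
  obtain ⟨a, rfl⟩ := h
  rw [← add_assoc, he]

end Order

variable (M : Type u) [AddCommMonoid M]

/-- `x + y = 0` only for `x = y = 0`. -/
def IsConical : Prop := ∀ x y : M, x + y = 0 → x = 0 ∧ y = 0

/-- `2x ≤ x` for all `x`, in the algebraic preordering. -/
def IsRegular : Prop := ∀ x : M, AlgLE (2 • x) x

/-- The Riesz refinement property. -/
def IsRefinement : Prop :=
  ∀ a b : Fin 2 → M, a 0 + a 1 = b 0 + b 1 →
    ∃ c : Fin 2 → Fin 2 → M, ∀ i, a i = c i 0 + c i 1 ∧ b i = c 0 i + c 1 i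

/-- The idempotents of `M`. -/
def Idem : Type u := {e : M // 2 • e = e}

variable {M}

theorem Idem.add_self (e : Idem M) : e.1 + e.1 = e.1 := by
  rw [← two_nsmul]; exact e.2

/-- The set `{x | e ≤ x ≤ e}`, for an idempotent `e`; it is an abelian group with neutral
element `e` under the addition of `M`. -/
def GroupAt (e : Idem M) : Type u := {x : M // AlgLE e.1 x ∧ AlgLE x e.1}

namespace GroupAt

variable {e : Idem M}

theorem ext {x y : GroupAt e} (h : x.1 = y.1) : x = y := Subtype.ext h

instance : Add (GroupAt e) :=
  ⟨fun x y => ⟨x.1 + y.1, by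
    have h1 := x.2.1.add y.2.1
    have h2 := x.2.2.add y.2.2
    rw [e.add_self] at h1 h2
    exact ⟨h1, h2⟩⟩⟩

instance : Zero (GroupAt e) := ⟨⟨e.1, AlgLE.refl _, AlgLE.refl _⟩⟩

theorem val_add (x y : GroupAt e) : (x + y).1 = x.1 + y.1 := rfl

theorem val_zero : (0 : GroupAt e).1 = e.1 := rfl

theorem exists_neg (x : GroupAt e) : ∃ y : GroupAt e, y + x = 0 := by
  obtain ⟨w, hw⟩ := x.2.2
  refine ⟨⟨w + e.1, ⟨w, add_comm _ _⟩, ⟨x.1, ?_⟩⟩, ext ?_⟩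
  · rw [add_comm, ← add_assoc, hw, e.add_self]
  · change w + e.1 + x.1 = e.1
    rw [add_comm, ← add_assoc, hw, e.add_self]

noncomputable instance : Neg (GroupAt e) := ⟨fun x => (exists_neg x).choose⟩

noncomputable instance : AddCommGroup (GroupAt e) where
  add_assoc x y z := ext (add_assoc x.1 y.1 z.1)
  zero_add x := ext (x.2.1.add_eq e.add_self)
  add_zero x := ext ((add_comm x.1 e.1).trans (x.2.1.add_eq e.add_self))
  neg_add_cancel x := (exists_neg x).choose_spec
  add_comm x y := ext (add_comm x.1 y.1)
  nsmul := nsmulRec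
  zsmul := zsmulRec

end GroupAt

/-- For idempotents `a ≤ b`, the natural map `x ↦ x + b` from the group at `a` to the group
at `b`. -/
def naturalMap {a b : Idem M} (h : AlgLE a.1 b.1) : GroupAt a →+ GroupAt b where
  toFun x := ⟨x.1 + b.1, ⟨x.1, add_comm _ _⟩, by
    have h1 := (x.2.2.trans h).add (AlgLE.refl b.1)
    rwa [b.add_self] at h1⟩
  map_zero' := GroupAt.ext (h.add_eq a.add_self)
  map_add' x y := GroupAt.ext (by
    change x.1 + y.1 + b.1 = (x.1 + b.1) + (y.1 + b.1)
    rw [add_add_add_comm, b.add_self])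

/-- Pure subgroups of an abelian group: an element of `H` that is divisible by `n` in `G` is
divisible by `n` in `H`. -/
def IsPureSubgroup {G : Type u} [AddCommGroup G] (H : AddSubgroup G) : Prop :=
  ∀ (n : ℕ) (g : G), n • g ∈ H → ∃ h ∈ H, n • h = n • g

variable (M)

/-- The embedding condition. -/
def EmbCondition : Prop :=
  ∀ (a b : Idem M) (h : AlgLE a.1 b.1), Function.Injective (naturalMap h)

/-- The purity condition. -/
def PurCondition : Prop :=
  ∀ (a b : Idem M) (h : AlgLE a.1 b.1), IsPureSubgroup (naturalMap h).range

/-- `M` is of the form `(ℤ/nℤ) ⊔ {0}` with `n` positive, or `ℤ ⊔ {0}`, up to isomorphism. -/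
def IsBlock : Prop :=
  (∃ n : ℕ, 0 < n ∧ Nonempty (M ≃+ WithZero (ZMod n))) ∨ Nonempty (M ≃+ WithZero ℤ)

/-- `M` is isomorphic to a (possibly empty) finite direct sum of blocks. -/
def IsFiniteSumOfBlocks : Prop :=
  ∃ (k : ℕ) (B : Fin k → Type) (_ : ∀ i, AddCommMonoid (B i)),
    (∀ i, IsBlock (B i)) ∧ Nonempty (M ≃+ (∀ i, B i))

/-- `M` is isomorphic to the direct limit of a system, indexed by a nonempty directed poset,
of finite direct sums of blocks and monoid homomorphisms. -/
def IsDirectLimitOfFiniteSumsOfBlocks : Prop :=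
  ∃ (ι : Type u) (_ : PartialOrder ι) (_ : IsDirectedOrder ι) (_ : Nonempty ι)
    (A : ι → Type u) (_ : ∀ i, AddCommMonoid (A i))
    (f : ∀ i j : ι, i ≤ j → A i →+ A j) (_ : DirectedSystem A (f · · ·)),
    (∀ i, IsFiniteSumOfBlocks (A i)) ∧ Nonempty (M ≃+ DirectLimit A f)

end RegMon

namespace RegMon

universe u

/-! Sufficiency. Each x is determined by its idempotent `eps x` and its image `gam x` in the
Grothendieck group G; this is (emb). Sending an order ideal I to the subgroup `gsub I` of G respects
finite joins and, by refinement, binary meets, and by (pur) its values are pure.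

Let x_i generate a finitely generated submonoid N, and let H be the subgroup of G generated by the
`gam (x i)`. Consider the intersections `capIdeal x S` of the principal ideals of the x_i, i ∈ S.
`exists_splitting` writes the inclusion H → G as a sum of maps l_S into `gsub (capIdeal x S)`, where
l_S kills whatever lies in the subgroup of some x_i with i ∉ S. Purity enters through
`exists_lift_of_pure`. Only the essential S contribute, and their ideals are join-prime, so "the
ideal of S lies below the ideal of y" is an additive condition on y. Hence y ↦ (l_S (gam y) if that
holds, else 0) is a homomorphism from N to the sum of the monoids `range l_S ⊔ {0}`. Mapping each
range into the group at a large enough idempotent of its ideal gives a map back to M, and the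
composite is the inclusion of N. The ranges decompose into cyclic groups. Such factorizations for
all finite subsets assemble into a direct system with limit M.

Necessity. The conditions amount to solvability of finite systems of equations, which holds in G ⊔
{0} and passes to products and direct limits. -/

/-- A regular monoid presented by its idempotent part `eps` and its image `gam` in an abelian
group, which together determine each element. -/
structure Coord (M G : Type u) [AddCommMonoid M] [AddCommGroup G] where
  eps : M →+ M
  gam : M →+ G
  eps_eps : ∀ x, eps (eps x) = eps x
  eps_add_self : ∀ x, eps x + x = x
  exists_add_eq_eps : ∀ x, ∃ w, x + w = eps x
  inj : ∀ x y, eps x = eps y → gam x = gam y → x = y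
  gam_surjective : Function.Surjective gam
  refinement : IsRefinement M
  conical : IsConical M
  pure : ∀ (n : ℕ) (x y : M), eps x + eps y = eps y → n • gam y = gam x →
    ∃ h, eps h = eps x ∧ n • gam h = gam x

/-! ### Coordinates of a regular monoid: idempotent part and group part. -/

section Construction

variable {M : Type u} [AddCommMonoid M]

theorem AlgLE.antisymm_of_idem {a b : M} (ha : a + a = a) (hb : b + b = b) (h : AlgLE a b)
    (h' : AlgLE b a) : a = b := by
  rw [← h'.add_eq hb, add_comm, h.add_eq ha]

theorem IsRegular.exists_idem (hr : IsRegular M) (x : M) :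
    ∃ e, e + e = e ∧ AlgLE e x ∧ AlgLE x e := by
  obtain ⟨z, hz⟩ := hr x
  rw [two_nsmul] at hz
  refine ⟨x + z, ?_, ⟨x, ?_⟩, ⟨z, rfl⟩⟩
  · calc x + z + (x + z) = (x + x + z) + z := by abel
      _ = x + z := by rw [hz]
  · calc x + z + x = x + x + z := by abel
      _ = x := hz

/-- The idempotent of the archimedean component of `x`. -/
noncomputable def IsRegular.eps (hr : IsRegular M) : M →+ M where
  toFun x := (hr.exists_idem x).choose
  map_zero' := by
    obtain ⟨h1, ⟨z, h2⟩, h3⟩ := (hr.exists_idem (0 : M)).choose_spec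
    exact AlgLE.antisymm_of_idem h1 (add_zero 0) ⟨z, h2⟩ h3
  map_add' x y := by
    obtain ⟨h1, h2, h3⟩ := (hr.exists_idem x).choose_spec
    obtain ⟨k1, k2, k3⟩ := (hr.exists_idem y).choose_spec
    obtain ⟨l1, l2, l3⟩ := (hr.exists_idem (x + y)).choose_spec
    refine AlgLE.antisymm_of_idem l1 ?_ (l2.trans (h3.add k3)) ((h2.add k2).trans l3)
    rw [add_add_add_comm, h1, k1]

theorem IsRegular.eps_spec (hr : IsRegular M) (x : M) :
    hr.eps x + hr.eps x = hr.eps x ∧ AlgLE (hr.eps x) x ∧ AlgLE x (hr.eps x) :=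
  (hr.exists_idem x).choose_spec

theorem IsRegular.eps_eq (hr : IsRegular M) {x e : M} (he : e + e = e) (h : AlgLE e x)
    (h' : AlgLE x e) : hr.eps x = e :=
  have ⟨h1, h2, h3⟩ := hr.eps_spec x
  AlgLE.antisymm_of_idem h1 he (h2.trans h') (h.trans h3)

/-- Equality in the Grothendieck group means c + x = c + y for some c. Adding an element that turns
c into its idempotent makes x and y agree in the group at `eps x + eps c`, where (emb) applies. -/
theorem IsRegular.eq_of_gam_eq (hr : IsRegular M) (hemb : EmbCondition M) {x y : M}
    (h : hr.eps x = hr.eps y)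
    (h' : Algebra.GrothendieckAddGroup.of x = Algebra.GrothendieckAddGroup.of y) : x = y := by
  obtain ⟨⟨c, _⟩, hc⟩ := (AddLocalization.addMonoidOf (⊤ : AddSubmonoid M)).eq_iff_exists.1 h'
  obtain ⟨h1, h2, h3⟩ := hr.eps_spec x
  obtain ⟨k1, k2, k3⟩ := hr.eps_spec y
  obtain ⟨l1, l2, w, l3⟩ := hr.eps_spec c
  have hle : AlgLE (hr.eps x) (hr.eps x + hr.eps c) := ⟨_, rfl⟩
  have key := hemb ⟨hr.eps x, by rw [two_nsmul, h1]⟩ ⟨hr.eps x + hr.eps c, by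
    rw [two_nsmul, add_add_add_comm, h1, l1]⟩ hle
    (a₁ := ⟨x, h2, h3⟩) (a₂ := ⟨y, h ▸ k2, h ▸ k3⟩) (GroupAt.ext ?_)
  · exact congrArg Subtype.val key
  · change x + (hr.eps x + hr.eps c) = y + (hr.eps x + hr.eps c)
    dsimp only at hc
    rw [← l3]
    calc x + (hr.eps x + (c + w)) = (c + x) + (hr.eps x + w) := by abel
      _ = (c + y) + (hr.eps x + w) := by rw [hc]
      _ = _ := by abel

/-- For n = 0 the two sides are e and 0, which is why the degenerate multiple is treated separately
wherever purity is used. -/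
theorem GroupAt.val_nsmul {e : Idem M} (x : GroupAt e) {n : ℕ} (hn : n ≠ 0) :
    (n • x).1 = n • x.1 := by
  induction n with
  | zero => exact absurd rfl hn
  | succ n ih =>
    rcases eq_or_ne n 0 with rfl | h
    · simp
    · rw [succ_nsmul, succ_nsmul, GroupAt.val_add, ih h]

/-- The coordinates of a regular monoid satisfying the embedding and purity conditions. -/
noncomputable def Coord.ofConditions (hr : IsRegular M) (hc : IsConical M) (hR : IsRefinement M)
    (hemb : EmbCondition M) (hpur : PurCondition M) :
    Coord M (Algebra.GrothendieckAddGroup M) where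
  eps := hr.eps
  gam := Algebra.GrothendieckAddGroup.of
  eps_eps x := by
    have h := (hr.eps_spec x).1
    exact hr.eps_eq h (AlgLE.refl _) (AlgLE.refl _)
  eps_add_self x := by
    obtain ⟨h1, h2, h3⟩ := hr.eps_spec x
    exact h2.add_eq h1
  exists_add_eq_eps x := (hr.eps_spec x).2.2
  inj x y := hr.eq_of_gam_eq hemb
  gam_surjective g := by
    induction g using AddLocalization.ind with
    | _ p =>
    obtain ⟨x, ⟨s, hs⟩⟩ := p
    obtain ⟨h1, ⟨v, h2⟩, ⟨w, h3⟩⟩ := hr.eps_spec s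
    -- The difference of x and s is the image of x + w, since s + w is an idempotent and idempotents
    -- die in the group.
    refine ⟨x + w, ?_⟩
    rw [AddLocalization.mk_eq_addMonoidOf_mk'_apply, eq_comm,
      AddSubmonoid.LocalizationMap.mk'_eq_iff_eq_add]
    change _ = Algebra.GrothendieckAddGroup.of (x + w) + Algebra.GrothendieckAddGroup.of s
    rw [← map_add, add_assoc, add_comm w, h3, map_add]
    have : (Algebra.GrothendieckAddGroup.of (hr.eps s) : Algebra.GrothendieckAddGroup M) = 0 := by
      have := congrArg (Algebra.GrothendieckAddGroup.of (M := M)) h1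
      rwa [map_add, add_eq_left] at this
    rw [this, add_zero]
    rfl
  refinement := hR
  conical := hc
  pure n x y hxy hg := by
    obtain ⟨h1, h2, h3⟩ := hr.eps_spec x
    obtain ⟨k1, k2, k3⟩ := hr.eps_spec y
    rcases eq_or_ne n 0 with rfl | hn
    · exact ⟨x, rfl, by rw [← hg, zero_nsmul, zero_nsmul]⟩
    have hle : AlgLE (hr.eps x) (hr.eps y) := ⟨_, hxy⟩
    let a : Idem M := ⟨hr.eps x, by rw [two_nsmul, h1]⟩
    let b : Idem M := ⟨hr.eps y, by rw [two_nsmul, k1]⟩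
    have hab : AlgLE a.1 b.1 := hle
    let X : GroupAt a := ⟨x, h2, h3⟩
    let Y : GroupAt b := ⟨y, k2, k3⟩
    have e0 : ∀ z : M, hr.eps (n • z) = hr.eps z := by
      intro z
      obtain ⟨m, rfl⟩ := Nat.exists_eq_succ_of_ne_zero hn
      rw [map_nsmul]
      clear hg hn
      induction m with
      | zero => simp
      | succ m ih => rw [succ_nsmul, ih, (hr.eps_spec z).1]
    have gi : (Algebra.GrothendieckAddGroup.of (hr.eps y) : Algebra.GrothendieckAddGroup M) = 0 := by
      have := congrArg (Algebra.GrothendieckAddGroup.of (M := M)) k1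
      rwa [map_add, add_eq_left] at this
    have hXY : n • Y = naturalMap hab X := by
      apply GroupAt.ext
      rw [GroupAt.val_nsmul _ hn]
      change n • y = x + hr.eps y
      apply hr.eq_of_gam_eq hemb
      · rw [e0, map_add, hr.eps_eq k1 (AlgLE.refl _) (AlgLE.refl _), hxy]
      · rw [map_nsmul, hg, map_add, gi, add_zero]
    obtain ⟨_, ⟨⟨h, hh1, hh2⟩, rfl⟩, hh⟩ := hpur a b hab n Y (hXY ▸ ⟨X, rfl⟩)
    have hh' := congrArg Subtype.val hh
    rw [GroupAt.val_nsmul _ hn, hXY] at hh'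
    change n • (h + hr.eps y) = x + hr.eps y at hh'
    refine ⟨h, hr.eps_eq h1 hh1 hh2, ?_⟩
    have := congrArg (Algebra.GrothendieckAddGroup.of (M := M)) hh'
    rwa [map_nsmul, map_add, map_add, gi, add_zero, add_zero] at this

end Construction

/-! ### The distributive lattice of order ideals. -/

/-- Order ideals of a monoid for the algebraic preordering. -/
def IsOIdeal {M : Type u} [AddCommMonoid M] (I : AddSubmonoid M) : Prop :=
  ∀ x y, x + y ∈ I → x ∈ I

namespace IsOIdeal

variable {M : Type u} [AddCommMonoid M] {I J K : AddSubmonoid M}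

theorem right (hI : IsOIdeal I) {x y : M} (h : x + y ∈ I) : y ∈ I :=
  hI y x (add_comm x y ▸ h)

theorem inf (hI : IsOIdeal I) (hJ : IsOIdeal J) : IsOIdeal (I ⊓ J) :=
  fun x y h => ⟨hI x y h.1, hJ x y h.2⟩

theorem bot (hc : IsConical M) : IsOIdeal (⊥ : AddSubmonoid M) :=
  fun x y h => (hc x y h).1

/-- Refining x + y = a + b with a ∈ I and b ∈ J splits x into a summand of a and a summand of b. -/
theorem sup (hR : IsRefinement M) (hI : IsOIdeal I) (hJ : IsOIdeal J) : IsOIdeal (I ⊔ J) := by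
  intro x y h
  obtain ⟨a, ha, b, hb, hab⟩ := AddSubmonoid.mem_sup.1 h
  obtain ⟨c, hc⟩ := hR ![x, y] ![a, b] hab.symm
  obtain ⟨h1, h2⟩ := hc 0
  obtain ⟨h3, h4⟩ := hc 1
  simp only [Matrix.cons_val_zero, Matrix.cons_val_one] at h1 h2 h3 h4
  subst h1 h2 h4
  exact AddSubmonoid.mem_sup.2 ⟨_, hI _ _ ha, _, hJ _ _ hb, rfl⟩

theorem finsetSup (hc : IsConical M) (hR : IsRefinement M) {ι : Type*} (U : Finset ι)
    {f : ι → AddSubmonoid M} (hf : ∀ i ∈ U, IsOIdeal (f i)) : IsOIdeal (U.sup f) :=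
  Finset.sup_induction (bot hc) (fun _ h _ h' => sup hR h h') hf

theorem finsetInf {ι : Type*} (U : Finset ι)
    {f : ι → AddSubmonoid M} (hf : ∀ i ∈ U, IsOIdeal (f i)) : IsOIdeal (U.inf f) :=
  Finset.inf_induction (fun _ _ _ => AddSubmonoid.mem_top _) (fun _ h _ h' => inf h h') hf

theorem inf_sup_le (hK : IsOIdeal K) : K ⊓ (I ⊔ J) ≤ K ⊓ I ⊔ K ⊓ J := by
  rintro x ⟨hx, hx'⟩
  obtain ⟨a, ha, b, hb, rfl⟩ := AddSubmonoid.mem_sup.1 hx'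
  exact AddSubmonoid.mem_sup.2 ⟨a, ⟨hK _ _ hx, ha⟩, b, ⟨hK.right hx, hb⟩, rfl⟩

theorem inf_finsetSup_le (hK : IsOIdeal K) {ι : Type*} (U : Finset ι)
    (f : ι → AddSubmonoid M) : K ⊓ U.sup f ≤ U.sup fun i => K ⊓ f i := by
  classical
  induction U using Finset.induction_on with
  | empty => simp
  | insert i U _ ih =>
    rw [Finset.sup_insert, Finset.sup_insert]
    exact hK.inf_sup_le.trans (sup_le_sup_left ih _)

end IsOIdeal

/-! ### From order ideals to pure subgroups of G. -/

namespace Coord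

variable {M G : Type u} [AddCommMonoid M] [AddCommGroup G] (c : Coord M G)
include c

theorem eps_add_eps (x : M) : c.eps x + c.eps x = c.eps x := by
  simpa only [c.eps_eps] using c.eps_add_self (c.eps x)

theorem gam_eps (x : M) : c.gam (c.eps x) = 0 := by
  have := congrArg c.gam (c.eps_add_self x)
  rwa [map_add, add_eq_right] at this

theorem exists_neg (x : M) : ∃ w, c.eps w = c.eps x ∧ x + w = c.eps x := by
  obtain ⟨w, hw⟩ := c.exists_add_eq_eps x
  refine ⟨w + c.eps x, ?_, ?_⟩
  · have := congrArg c.eps hw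
    rw [map_add, c.eps_eps] at this
    rw [map_add, c.eps_eps, add_comm, this]
  · rw [← add_assoc, hw, c.eps_add_eps]

/-- The order ideal generated by `x`. -/
def princ (x : M) : AddSubmonoid M where
  carrier := {y | c.eps y + c.eps x = c.eps x}
  zero_mem' := by simp
  add_mem' {y z} hy hz := by
    simp only [Set.mem_ofPred_eq] at *
    rw [map_add, add_assoc, hz, hy]

theorem mem_princ {x y : M} : y ∈ c.princ x ↔ c.eps y + c.eps x = c.eps x := Iff.rfl

theorem self_mem_princ (x : M) : x ∈ c.princ x := c.eps_add_eps x

theorem isOIdeal_princ (x : M) : IsOIdeal (c.princ x) := by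
  intro y z h
  rw [mem_princ] at *
  rw [← h, map_add, ← add_assoc, ← add_assoc, c.eps_add_eps]

theorem princ_zero : c.princ 0 = ⊥ := by
  refine (AddSubmonoid.eq_bot_iff_forall _).2 fun x hx => ?_
  rw [mem_princ, map_zero, add_zero] at hx
  obtain ⟨w, hw⟩ := c.exists_add_eq_eps x
  exact (c.conical x w (hw.trans hx)).1

theorem eps_mem {I : AddSubmonoid M} (hI : IsOIdeal I) {x : M} : c.eps x ∈ I ↔ x ∈ I := by
  constructor
  · obtain ⟨w, hw⟩ := c.exists_add_eq_eps x
    exact fun h => hI x w (hw ▸ h)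
  · exact fun h => hI (c.eps x) x (by rwa [c.eps_add_self])

theorem princ_le {I : AddSubmonoid M} (hI : IsOIdeal I) {x : M} : c.princ x ≤ I ↔ x ∈ I := by
  refine ⟨fun h => h (c.self_mem_princ x), fun h y hy => ?_⟩
  rw [← c.eps_mem hI] at h ⊢
  rw [mem_princ] at hy
  exact hI _ _ (hy.symm ▸ h)

theorem princ_add (x y : M) : c.princ (x + y) = c.princ x ⊔ c.princ y := by
  apply le_antisymm
  · rw [c.princ_le (IsOIdeal.sup c.refinement (c.isOIdeal_princ x) (c.isOIdeal_princ y))]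
    exact AddSubmonoid.add_mem_sup (c.self_mem_princ x) (c.self_mem_princ y)
  · have := c.self_mem_princ (x + y)
    rw [sup_le_iff, c.princ_le (c.isOIdeal_princ _), c.princ_le (c.isOIdeal_princ _)]
    exact ⟨c.isOIdeal_princ _ _ _ this, (c.isOIdeal_princ _).right this⟩

/-- The subgroup generated by the image of a submonoid. -/
def gsub (I : AddSubmonoid M) : AddSubgroup G := AddSubgroup.closure (c.gam '' I)

theorem gam_mem_gsub {I : AddSubmonoid M} {x : M} (h : x ∈ I) : c.gam x ∈ c.gsub I :=
  AddSubgroup.subset_closure ⟨x, h, rfl⟩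

theorem gsub_mono {I J : AddSubmonoid M} (h : I ≤ J) : c.gsub I ≤ c.gsub J :=
  AddSubgroup.closure_mono (Set.image_mono h)

/-- The image of I is already a group: an opposite of x can be chosen with the same idempotent as x,
hence inside I. -/
theorem mem_gsub {I : AddSubmonoid M} (hI : IsOIdeal I) {g : G} :
    g ∈ c.gsub I ↔ ∃ x ∈ I, c.gam x = g := by
  constructor
  · intro h
    induction h using AddSubgroup.closure_induction with
    | mem g hg => exact hg
    | zero => exact ⟨0, I.zero_mem, map_zero _⟩
    | add g g' _ _ h h' =>
      obtain ⟨x, hx, rfl⟩ := h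
      obtain ⟨y, hy, rfl⟩ := h'
      exact ⟨x + y, I.add_mem hx hy, map_add _ _ _⟩
    | neg g _ h =>
      obtain ⟨x, hx, rfl⟩ := h
      obtain ⟨w, hw, hw'⟩ := c.exists_neg x
      refine ⟨w, by rwa [← c.eps_mem hI, hw, c.eps_mem hI], ?_⟩
      rw [eq_neg_iff_add_eq_zero, ← map_add, add_comm, hw', c.gam_eps]
  · rintro ⟨x, hx, rfl⟩
    exact c.gam_mem_gsub hx

theorem gsub_top : c.gsub ⊤ = ⊤ := by
  refine eq_top_iff.2 fun g _ => ?_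
  obtain ⟨x, rfl⟩ := c.gam_surjective g
  exact c.gam_mem_gsub (AddSubmonoid.mem_top x)

theorem gsub_sup (I J : AddSubmonoid M) : c.gsub (I ⊔ J) ≤ c.gsub I ⊔ c.gsub J := by
  refine (AddSubgroup.closure_le _).2 ?_
  rintro _ ⟨x, hx, rfl⟩
  obtain ⟨a, ha, b, hb, rfl⟩ := AddSubmonoid.mem_sup.1 hx
  rw [map_add]
  exact AddSubgroup.add_mem_sup (c.gam_mem_gsub ha) (c.gam_mem_gsub hb)

theorem gsub_inf {I J : AddSubmonoid M} (hI : IsOIdeal I) (hJ : IsOIdeal J) :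
    c.gsub I ⊓ c.gsub J ≤ c.gsub (I ⊓ J) := by
  rintro g ⟨h, h'⟩
  obtain ⟨x, hx, rfl⟩ := (c.mem_gsub hI).1 h
  obtain ⟨y, hy, hyx⟩ := (c.mem_gsub hJ).1 h'
  -- Elements x ∈ I and y ∈ J with the same image become equal once their idempotents are equalized.
  -- In a refinement of this equation `d 0 0` and `d 1 1` lie in both ideals, and `d 0 1` is
  -- opposite to `d 1 1` in G because their sum is `eps x`.
  have e : x + c.eps y = y + c.eps x := by
    apply c.inj
    · rw [map_add, map_add, c.eps_eps, c.eps_eps, add_comm]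
    · rw [map_add, map_add, c.gam_eps, c.gam_eps, hyx]
  obtain ⟨d, hd⟩ := c.refinement ![x, c.eps y] ![y, c.eps x] e
  obtain ⟨h1, h2⟩ := hd 0
  obtain ⟨h3, h4⟩ := hd 1
  simp only [Matrix.cons_val_zero, Matrix.cons_val_one] at h1 h2 h3 h4
  have h00 : d 0 0 ∈ I ⊓ J := ⟨hI _ _ (h1 ▸ hx), hJ _ _ (h2 ▸ hy)⟩
  have h11 : d 1 1 ∈ I ⊓ J := by
    refine ⟨hI.right (x := d 0 1) ?_, hJ.right (x := d 1 0) ?_⟩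
    · rwa [← h4, c.eps_mem hI]
    · rwa [← h3, c.eps_mem hJ]
  have g1 : c.gam (d 0 1) = - c.gam (d 1 1) := by
    rw [eq_neg_iff_add_eq_zero, ← map_add, ← h4, c.gam_eps]
  rw [h1, map_add, g1]
  exact add_mem (c.gam_mem_gsub h00) (neg_mem (c.gam_mem_gsub h11))

theorem isPureSubgroup_gsub {I : AddSubmonoid M} (hI : IsOIdeal I) :
    IsPureSubgroup (c.gsub I) := by
  intro n g hg
  obtain ⟨x, hx, hxg⟩ := (c.mem_gsub hI).1 hg
  obtain ⟨y, rfl⟩ := c.gam_surjective g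
  -- Adding `eps x` to y puts its idempotent above that of x without changing its image in G.
  obtain ⟨h, h1, h2⟩ := c.pure n x (c.eps x + y)
    (by rw [map_add, c.eps_eps, ← add_assoc, c.eps_add_eps])
    (by rw [map_add, c.gam_eps, zero_add, hxg])
  refine ⟨c.gam h, c.gam_mem_gsub ?_, h2.trans hxg⟩
  rwa [← c.eps_mem hI, h1, c.eps_mem hI]

end Coord
-- Lifting maps of finitely generated abelian groups modulo a subgroup.
open scoped DirectSum in
/-- A finitely generated abelian group is a finite direct sum of cyclic groups. -/
theorem exists_addEquiv_pi_zmod (H : Type u) [AddCommGroup H] (hH : AddGroup.FG H) :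
    ∃ (σ : Type) (_ : Fintype σ) (n : σ → ℕ), Nonempty (H ≃+ ∀ s, ZMod (n s)) := by
  classical
  obtain ⟨n, ι, _, p, _, e, ⟨f⟩⟩ := AddCommGroup.equiv_free_prod_directSum_zmod H
  refine ⟨Fin n ⊕ ι, inferInstance, Sum.elim (fun _ => 0) (fun i => p i ^ e i), ⟨?_⟩⟩
  refine (f.trans (AddEquiv.prodCongr (Finsupp.linearEquivFunOnFinite ℤ ℤ (Fin n)).toAddEquiv
    (DirectSum.addEquivProd (fun i => ZMod (p i ^ e i))))).trans
    { toFun := fun x s => match s with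
        | Sum.inl i => x.1 i
        | Sum.inr i => x.2 i
      invFun := fun x => (fun i => x (Sum.inl i), fun i => x (Sum.inr i))
      left_inv := fun x => rfl
      right_inv := fun x => by ext s; cases s <;> rfl
      map_add' := fun x y => by ext s; cases s <;> rfl }

theorem zmod_hom_ext {n : ℕ} {A : Type*} [AddCommGroup A] {f g : ZMod n →+ A}
    (h : f 1 = g 1) : f = g := by
  ext z
  obtain ⟨k, rfl⟩ := ZMod.intCast_surjective z
  rw [← zsmul_one, map_zsmul, map_zsmul, h]

/-- Purity of `L ⊓ N` splits off, on a finitely generated group, the part of a map into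
`L ⊔ N` that survives modulo `N`. -/
theorem exists_lift_of_pure {G H : Type u} [AddCommGroup G] [AddCommGroup H]
    (hH : AddGroup.FG H) {L N : AddSubgroup G} (hLN : IsPureSubgroup (L ⊓ N)) (h : H →+ G)
    (hh : ∀ x, h x ∈ L ⊔ N) :
    ∃ l : H →+ G, (∀ x, l x ∈ L) ∧ (∀ x, h x ∈ N → l x = 0) ∧ ∀ x, h x - l x ∈ N := by
  classical
  -- The lift is built on H/Z, a sum of cyclic groups, so it automatically vanishes where h lands in
  -- N.
  let Z := N.comap h
  obtain ⟨σ, _, n, ⟨e⟩⟩ := exists_addEquiv_pi_zmod (H ⧸ Z) (@QuotientAddGroup.fg H _ hH Z _)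
  have key : ∀ s, ∃ (x : H) (k : G), e (QuotientAddGroup.mk x) = Pi.single s 1 ∧ k ∈ L ∧
      n s • k = 0 ∧ h x - k ∈ N := by
    intro s
    obtain ⟨x, hx⟩ := QuotientAddGroup.mk_surjective (e.symm (Pi.single s 1))
    obtain ⟨a, ha, b, hb, hab⟩ := AddSubgroup.mem_sup.1 (hh x)
    have hnx : n s • x ∈ Z := by
      rw [← QuotientAddGroup.eq_zero_iff, QuotientAddGroup.mk_nsmul, hx, ← map_nsmul,
        ← Pi.single_smul]
      simp
    have hna : n s • a ∈ L ⊓ N := by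
      refine ⟨nsmul_mem ha _, ?_⟩
      have h1 : n s • h x ∈ N := by simpa [Z] using hnx
      rw [← hab, nsmul_add] at h1
      exact (N.add_mem_cancel_right (nsmul_mem hb _)).1 h1
    -- By purity a can be corrected inside L ⊓ N so that its order divides `n s`; the class modulo N
    -- is unchanged.
    obtain ⟨k, ⟨hk, hk'⟩, hk2⟩ := hLN _ _ hna
    refine ⟨x, a - k, by rw [hx, e.apply_symm_apply], sub_mem ha hk, ?_, ?_⟩
    · rw [nsmul_sub, hk2, sub_self]
    · rw [← hab]
      have : a + b - (a - k) = b + k := by abel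
      rw [this]
      exact add_mem hb hk'
  choose x k hx hkL hnk hxk using key
  let t : ∀ s, ZMod (n s) →+ G := fun s =>
    ZMod.lift (n s) ⟨zmultiplesHom G (k s), by simpa using hnk s⟩
  have ht1 : ∀ s, t s 1 = k s := by
    intro s
    have := ZMod.lift_coe (n s) (⟨zmultiplesHom G (k s), by simpa using hnk s⟩ :
      {f : ℤ →+ G // f (n s) = 0}) 1
    simpa using this
  have htL : ∀ s z, t s z ∈ L := by
    intro s z
    obtain ⟨m, rfl⟩ := ZMod.intCast_surjective z
    rw [← zsmul_one, map_zsmul, ht1]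
    exact zsmul_mem (hkL s) m
  let T : (∀ s, ZMod (n s)) →+ G := ∑ s, (t s).comp (Pi.evalAddMonoidHom _ s)
  have hT : ∀ v, T v = ∑ s, t s (v s) := fun v => by simp [T]
  let l : H →+ G := T.comp (e.toAddMonoidHom.comp (QuotientAddGroup.mk' Z))
  have hl : ∀ y, l y = T (e (QuotientAddGroup.mk y)) := fun y => rfl
  refine ⟨l, fun y => ?_, fun y hy => ?_, fun y => ?_⟩
  · rw [hl, hT]
    exact sum_mem fun s _ => htL s _
  · rw [hl, (QuotientAddGroup.eq_zero_iff y).2 hy, map_zero, map_zero]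
  · let hbar : H ⧸ Z →+ G ⧸ N := QuotientAddGroup.map Z N h le_rfl
    have : hbar.comp e.symm.toAddMonoidHom = (QuotientAddGroup.mk' N).comp T := by
      refine AddMonoidHom.functions_ext' _ _ _ fun s => zmod_hom_ext ?_
      change hbar (e.symm (Pi.single s 1)) = QuotientAddGroup.mk' N (T (Pi.single s 1))
      rw [← hx, e.symm_apply_apply, hx, hT, Finset.sum_eq_single s (fun b _ hb => by
        rw [Pi.single_eq_of_ne hb, map_zero]) (by simp), Pi.single_eq_same, ht1]
      change QuotientAddGroup.mk (h (x s)) = QuotientAddGroup.mk (k s)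
      rw [eq_comm, QuotientAddGroup.eq, neg_add_eq_sub]
      exact hxk s
    have h2 := DFunLike.congr_fun this (e (QuotientAddGroup.mk y))
    change hbar (e.symm (e _)) = QuotientAddGroup.mk (l y) at h2
    rw [e.symm_apply_apply] at h2
    change QuotientAddGroup.mk (h y) = _ at h2
    rw [eq_comm, QuotientAddGroup.eq, neg_add_eq_sub] at h2
    exact h2

/-! ### Splitting a map along intersections of principal ideals. -/

namespace Coord

variable {M G : Type u} [AddCommMonoid M] [AddCommGroup G] (c : Coord M G)
  {ι : Type} [Fintype ι] [DecidableEq ι] (x : ι → M)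
include c

/-- The intersection of the order ideals generated by the `x i`, for `i ∈ S`. -/
def capIdeal (S : Finset ι) : AddSubmonoid M := S.inf fun i => c.princ (x i)

/-- The ideals that are not joins of smaller intersections. -/
def Essential (S : Finset ι) : Prop :=
  ¬ c.capIdeal x S ≤ (Finset.univ.filter fun S' => S ⊂ S').sup (c.capIdeal x)

omit [Fintype ι] [DecidableEq ι] in
theorem isOIdeal_capIdeal (S : Finset ι) : IsOIdeal (c.capIdeal x S) :=
  IsOIdeal.finsetInf _ fun _ _ => c.isOIdeal_princ _

omit [Fintype ι] [DecidableEq ι] in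
theorem isOIdeal_sup_capIdeal (U : Finset (Finset ι)) : IsOIdeal (U.sup (c.capIdeal x)) :=
  IsOIdeal.finsetSup c.conical c.refinement U fun _ _ => c.isOIdeal_capIdeal x _

omit [Fintype ι] [DecidableEq ι] in
theorem capIdeal_le_princ {S : Finset ι} {i : ι} (hi : i ∈ S) :
    c.capIdeal x S ≤ c.princ (x i) := Finset.inf_le hi

omit [Fintype ι] in
theorem princ_inf_capIdeal (S : Finset ι) (i : ι) :
    c.princ (x i) ⊓ c.capIdeal x S = c.capIdeal x (insert i S) := by
  rw [capIdeal, capIdeal, Finset.inf_insert]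

/-- A map from a finitely generated group splits along the lattice of intersections of the
ideals generated by the `x i`. -/
theorem exists_splitting {H : Type u} [AddCommGroup H] (hH : AddGroup.FG H)
    (U : Finset (Finset ι)) (hU : ∀ S ∈ U, ∀ S', S ⊆ S' → S' ∈ U) (h : H →+ G)
    (hh : ∀ y, h y ∈ c.gsub (U.sup (c.capIdeal x))) :
    ∃ l : Finset ι → H →+ G, (∀ S y, l S y ∈ c.gsub (c.capIdeal x S)) ∧
      (∀ y, h y = ∑ S, l S y) ∧
      (∀ i y, h y ∈ c.gsub (c.princ (x i)) → ∀ S, i ∉ S → l S y = 0) ∧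
      (∀ S, ¬ c.Essential x S → l S = 0) ∧ ∀ S ∉ U, l S = 0 := by
  induction U using Finset.strongInduction generalizing h with
  | H U ih =>
  rcases U.eq_empty_or_nonempty with rfl | hne
  · have h0 : ∀ y, h y = 0 := by
      intro y
      obtain ⟨z, hz, hzy⟩ := (c.mem_gsub (c.isOIdeal_sup_capIdeal x ∅)).1 (hh y)
      rw [Finset.sup_empty] at hz
      rw [← hzy, (AddSubmonoid.mem_bot).1 hz, map_zero]
    refine ⟨0, by simp, by simpa using h0, by simp, by simp, by simp⟩
  -- Removing a smallest member keeps the family closed under supersets. Its ideal is peeled off,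
  -- and the induction handles the remainder.
  obtain ⟨S, hSU, hSmin⟩ := U.exists_min_image Finset.card hne
  have hmem : ∀ S' ∈ U, S' ≠ S → ∀ S'', S' ⊆ S'' → S'' ∈ U.erase S := by
    intro S' hS' hne' S'' hsub
    refine Finset.mem_erase.2 ⟨?_, hU _ hS' _ hsub⟩
    rintro rfl
    exact hne' (Finset.eq_of_subset_of_card_le hsub (hSmin _ hS'))
  have hU0 : ∀ S' ∈ U.erase S, ∀ S'', S' ⊆ S'' → S'' ∈ U.erase S := fun S' hS' =>
    hmem S' (Finset.mem_of_mem_erase hS') (Finset.ne_of_mem_erase hS')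
  have hsup : U.sup (c.capIdeal x) = c.capIdeal x S ⊔ (U.erase S).sup (c.capIdeal x) := by
    rw [← Finset.sup_insert, Finset.insert_erase hSU]
  have hO := c.isOIdeal_sup_capIdeal x (U.erase S)
  by_cases hle : c.capIdeal x S ≤ (U.erase S).sup (c.capIdeal x)
  · obtain ⟨l, h1, h2, h3, h4, h5⟩ := ih _ (Finset.erase_ssubset hSU) hU0 h (by
      intro y
      have := hh y
      rwa [hsup, sup_eq_right.2 hle] at this)
    exact ⟨l, h1, h2, h3, h4, fun S' hS' => h5 S' fun h' => hS' (Finset.mem_of_mem_erase h')⟩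
  · have hess : c.Essential x S := by
      refine fun h' => hle (h'.trans (Finset.sup_mono fun S' hS' => ?_))
      have hSS := (Finset.mem_filter.1 hS').2
      exact Finset.mem_erase.2 ⟨hSS.ne', hU _ hSU _ hSS.subset⟩
    have hpure : IsPureSubgroup (c.gsub (c.capIdeal x S) ⊓
        c.gsub ((U.erase S).sup (c.capIdeal x))) := by
      have : c.gsub (c.capIdeal x S) ⊓ c.gsub ((U.erase S).sup (c.capIdeal x)) =
          c.gsub (c.capIdeal x S ⊓ (U.erase S).sup (c.capIdeal x)) :=
        le_antisymm (c.gsub_inf (c.isOIdeal_capIdeal x S) hO)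
          (le_inf (c.gsub_mono inf_le_left) (c.gsub_mono inf_le_right))
      rw [this]
      exact c.isPureSubgroup_gsub ((c.isOIdeal_capIdeal x S).inf hO)
    obtain ⟨m, m1, m2, m3⟩ := exists_lift_of_pure hH hpure h fun y =>
      c.gsub_sup _ _ (hsup ▸ hh y)
    obtain ⟨l, h1, h2, h3, h4, h5⟩ := ih _ (Finset.erase_ssubset hSU) hU0 (h - m) m3
    have hlS : l S = 0 := h5 S (by simp)
    refine ⟨Function.update l S m, fun S' y => ?_, fun y => ?_, fun i y hy S' hi => ?_,
      fun S' hS' => ?_, fun S' hS' => ?_⟩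
    · rcases eq_or_ne S' S with rfl | hne'
      · simpa using m1 y
      · simpa [hne'] using h1 S' y
    · have := h2 y
      rw [AddMonoidHom.sub_apply, sub_eq_iff_eq_add] at this
      rw [this, ← Finset.add_sum_erase _ _ (Finset.mem_univ S),
        ← Finset.add_sum_erase _ _ (Finset.mem_univ S), hlS, Function.update_self,
        AddMonoidHom.zero_apply, zero_add, add_comm]
      congr 1
      refine Finset.sum_congr rfl fun S' hS' => ?_
      rw [Function.update_of_ne (Finset.ne_of_mem_erase hS')]
    · by_cases hiS : i ∈ S
      · rcases eq_or_ne S' S with rfl | hne'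
        · exact absurd hiS hi
        rw [Function.update_of_ne hne']
        refine h3 i y ?_ S' hi
        exact sub_mem hy (c.gsub_mono (c.capIdeal_le_princ x hiS) (m1 y))
      -- When i ∉ S, meeting with the ideal of x_i replaces every index set by one containing i,
      -- hence different from S. So h y already lies in the remaining part, and the peeled map kills
      -- it.
      · have hyN : h y ∈ c.gsub ((U.erase S).sup (c.capIdeal x)) := by
          have h6 := c.gsub_inf (c.isOIdeal_princ (x i)) (c.isOIdeal_sup_capIdeal x U) ⟨hy, hh y⟩
          refine c.gsub_mono (((c.isOIdeal_princ (x i)).inf_finsetSup_le _ _).trans ?_) h6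
          refine Finset.sup_le fun S'' hS'' => ?_
          rw [princ_inf_capIdeal]
          refine Finset.le_sup (f := c.capIdeal x) ?_
          refine Finset.mem_erase.2 ⟨fun h' => hiS (h' ▸ Finset.mem_insert_self _ _), ?_⟩
          exact hU _ hS'' _ (Finset.subset_insert _ _)
        have hm0 := m2 y hyN
        rcases eq_or_ne S' S with rfl | hne'
        · rwa [Function.update_self]
        · rw [Function.update_of_ne hne']
          refine h3 i y ?_ S' hi
          rwa [AddMonoidHom.sub_apply, hm0, sub_zero]
    · have : S' ≠ S := fun h' => hS' (h' ▸ hess)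
      rw [Function.update_of_ne this]
      exact h4 S' hS'
    · have : S' ≠ S := fun h' => hS' (h' ▸ hSU)
      rw [Function.update_of_ne this]
      exact h5 S' fun h' => hS' (Finset.mem_of_mem_erase h')

end Coord
theorem exists_sum_of_mem_finsetSup {M κ : Type*} [AddCommMonoid M] [DecidableEq κ]
    (I : κ → AddSubmonoid M) (U : Finset κ) {y : M} (hy : y ∈ U.sup I) :
    ∃ f : κ → M, (∀ k, f k ∈ I k) ∧ y = ∑ k ∈ U, f k := by
  induction U using Finset.induction_on generalizing y with
  | empty => exact ⟨0, fun k => zero_mem _, by simpa using hy⟩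
  | insert k U hk ih =>
    rw [Finset.sup_insert] at hy
    obtain ⟨a, ha, b, hb, rfl⟩ := AddSubmonoid.mem_sup.1 hy
    obtain ⟨f, hf, rfl⟩ := ih hb
    refine ⟨Function.update f k a, fun j => ?_, ?_⟩
    · rcases eq_or_ne j k with rfl | h
      · simpa using ha
      · simpa [h] using hf j
    · rw [Finset.sum_insert hk, Function.update_self]
      congr 1
      refine Finset.sum_congr rfl fun j hj => ?_
      rw [Function.update_of_ne (by rintro rfl; exact hk hj)]

/-! ### Essential intersections and the factorization through groups with zero. -/

namespace Coord

variable {M G : Type u} [AddCommMonoid M] [AddCommGroup G] (c : Coord M G)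
  {ι : Type} [Fintype ι] [DecidableEq ι] (x : ι → M)
include c

open Classical in
/-- The essential sets of indices. -/
noncomputable def essentials : Finset (Finset ι) := Finset.univ.filter (c.Essential x)

theorem mem_essentials {S : Finset ι} : S ∈ c.essentials x ↔ c.Essential x S := by
  simp [essentials]

/-- Induction from large sets down: an inessential intersection is covered by those of strict
supersets. -/
theorem capIdeal_le_sup_essentials (S : Finset ι) :
    c.capIdeal x S ≤ ((c.essentials x).filter (S ⊆ ·)).sup (c.capIdeal x) := by
  induction S using WellFoundedGT.induction with
  | ind S ih =>
  by_cases h : c.Essential x S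
  · exact Finset.le_sup (f := c.capIdeal x)
      (Finset.mem_filter.2 ⟨(c.mem_essentials x).2 h, subset_rfl⟩)
  · refine (not_not.1 h).trans (Finset.sup_le fun S' hS' => ?_)
    have hSS := (Finset.mem_filter.1 hS').2
    refine (ih S' hSS).trans (Finset.sup_mono fun S'' h'' => ?_)
    rw [Finset.mem_filter] at h'' ⊢
    exact ⟨h''.1, hSS.subset.trans h''.2⟩

variable {x} in
-- If C missed S, distributivity would cover the ideal of S by those of the strict supersets `insert
-- i S`, i ∈ C.
theorem Essential.exists_mem {S : Finset ι} (hS : c.Essential x S) {C : Finset ι}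
    (hC : c.capIdeal x S ≤ C.sup fun i => c.princ (x i)) : ∃ i ∈ C, i ∈ S := by
  by_contra! hn
  refine hS ?_
  calc c.capIdeal x S ≤ c.capIdeal x S ⊓ C.sup fun i => c.princ (x i) := le_inf le_rfl hC
    _ ≤ C.sup fun i => c.capIdeal x S ⊓ c.princ (x i) :=
      (c.isOIdeal_capIdeal x S).inf_finsetSup_le _ _
    _ ≤ _ := Finset.sup_le fun i hi => by
      rw [inf_comm, princ_inf_capIdeal]
      refine Finset.le_sup (f := c.capIdeal x) (Finset.mem_filter.2 ⟨Finset.mem_univ _, ?_⟩)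
      exact Finset.ssubset_insert (hn i hi)

omit [Fintype ι] in
theorem exists_princ_eq {y : M} (hy : y ∈ AddSubmonoid.closure (Set.range x)) :
    ∃ C : Finset ι, c.princ y = C.sup fun i => c.princ (x i) := by
  induction hy using AddSubmonoid.closure_induction with
  | mem _ h =>
    obtain ⟨i, rfl⟩ := h
    exact ⟨{i}, by simp⟩
  | zero => exact ⟨∅, by simp [princ_zero]⟩
  | add y z _ _ hy hz =>
    obtain ⟨C, hC⟩ := hy
    obtain ⟨D, hD⟩ := hz
    exact ⟨C ∪ D, by rw [princ_add, hC, hD, Finset.sup_union]⟩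

variable {x} in
-- Ideals of elements of the submonoid are joins of generating principal ideals, so
-- `Essential.exists_mem` yields join-primeness. This makes the support of the map out of the
-- submonoid additive.
theorem Essential.le_or_le {S : Finset ι} (hS : c.Essential x S) {y z : M}
    (hy : y ∈ AddSubmonoid.closure (Set.range x)) (hz : z ∈ AddSubmonoid.closure (Set.range x))
    (h : c.capIdeal x S ≤ c.princ (y + z)) :
    c.capIdeal x S ≤ c.princ y ∨ c.capIdeal x S ≤ c.princ z := by
  obtain ⟨C, hC⟩ := c.exists_princ_eq x hy
  obtain ⟨D, hD⟩ := c.exists_princ_eq x hz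
  rw [princ_add, hC, hD, ← Finset.sup_union] at h
  obtain ⟨i, hi, hiS⟩ := Essential.exists_mem c hS h
  have h1 := c.capIdeal_le_princ x hiS
  rcases Finset.mem_union.1 hi with hi | hi
  · exact Or.inl (h1.trans (hC ▸ Finset.le_sup (f := fun i => c.princ (x i)) hi))
  · exact Or.inr (h1.trans (hD ▸ Finset.le_sup (f := fun i => c.princ (x i)) hi))

variable {x} in
theorem Essential.not_le_princ_zero {S : Finset ι} (hS : c.Essential x S) :
    ¬ c.capIdeal x S ≤ c.princ 0 := by
  rw [princ_zero]
  exact fun h => hS (h.trans bot_le)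

/-- Idempotents in the ideals of the essential sets, large enough to carry given finitely
generated subgroups and to cover the idempotents of all the `x i`. -/
theorem exists_idempotents {H : Type u} [AddCommGroup H] (k : ι → H)
    (hk : AddSubgroup.closure (Set.range k) = ⊤) (l : Finset ι → H →+ G)
    (hl : ∀ S y, l S y ∈ c.gsub (c.capIdeal x S)) :
    ∃ f : Finset ι → M, (∀ S, f S ∈ c.capIdeal x S) ∧ (∀ S, c.eps (f S) = f S) ∧
      (∀ i, c.eps (x i) + ∑ S ∈ (c.essentials x).filter (i ∈ ·), f S =
        ∑ S ∈ (c.essentials x).filter (i ∈ ·), f S) ∧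
      ∀ S y, ∃ z, c.eps z = f S ∧ c.gam z = l S y := by
  have h1 : ∀ i, ∃ φ : Finset ι → M, (∀ S, φ S ∈ c.capIdeal x S) ∧
      x i = ∑ S ∈ (c.essentials x).filter (i ∈ ·), φ S := by
    intro i
    refine exists_sum_of_mem_finsetSup _ _ ?_
    have h := c.capIdeal_le_sup_essentials x {i}
    simp only [Finset.singleton_subset_iff] at h
    refine h ?_
    simpa [capIdeal] using c.self_mem_princ (x i)
  choose φ hφ hxφ using h1
  have h2 : ∀ S i, ∃ y ∈ c.capIdeal x S, c.gam y = l S (k i) := fun S i =>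
    (c.mem_gsub (c.isOIdeal_capIdeal x S)).1 (hl S (k i))
  choose q hq hql using h2
  -- The summands `φ i S` let the idempotents cover the x_i; the summands `q S i` make the group at
  -- `f S` contain the range of `l S`.
  let f : Finset ι → M := fun S => c.eps (∑ i, (φ i S + q S i))
  have hff : ∀ S, c.eps (f S) = f S := fun S => c.eps_eps _
  have hmem : ∀ S i, φ i S + q S i ∈ c.princ (f S) := by
    intro S i
    have h : ∑ i, (φ i S + q S i) ∈ c.princ (f S) := by
      rw [← c.eps_mem (c.isOIdeal_princ _)]
      exact c.self_mem_princ _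
    rw [← Finset.add_sum_erase _ _ (Finset.mem_univ i)] at h
    exact c.isOIdeal_princ _ _ _ h
  refine ⟨f, fun S => ?_, hff, fun i => ?_, fun S y => ?_⟩
  · rw [c.eps_mem (c.isOIdeal_capIdeal x S)]
    exact sum_mem fun i _ => add_mem (hφ i S) (hq S i)
  · conv_lhs => rw [hxφ i]
    rw [map_sum, ← Finset.sum_add_distrib]
    refine Finset.sum_congr rfl fun S _ => ?_
    have := c.isOIdeal_princ _ _ _ (hmem S i)
    rwa [mem_princ, hff] at this
  · have : l S y ∈ c.gsub (c.princ (f S)) := by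
      have hle : AddSubgroup.closure (Set.range k) ≤ (c.gsub (c.princ (f S))).comap (l S) := by
        rw [AddSubgroup.closure_le]
        rintro _ ⟨i, rfl⟩
        change l S (k i) ∈ c.gsub (c.princ (f S))
        rw [← hql]
        exact c.gam_mem_gsub ((c.isOIdeal_princ _).right (hmem S i))
      exact hle (hk ▸ AddSubgroup.mem_top y)
    obtain ⟨z, hz, hzy⟩ := (c.mem_gsub (c.isOIdeal_princ _)).1 this
    rw [mem_princ, hff] at hz
    refine ⟨z + f S, ?_, ?_⟩
    · rw [map_add, hff, hz]
    · rw [map_add, hzy, ← hff, c.gam_eps, add_zero]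

/-- The inclusion of a finitely generated submonoid factors through a finite direct sum of
monoids `K ⊔ {0}` with `K` a finitely generated abelian group. -/
theorem exists_factor_groups : ∃ (T : Type) (_ : Fintype T) (K : T → Type u)
    (_ : ∀ t, AddCommGroup (K t)), (∀ t, AddGroup.FG (K t)) ∧
    ∃ (s : AddSubmonoid.closure (Set.range x) →+ ∀ t, WithZero (K t))
      (p : (∀ t, WithZero (K t)) →+ M), ∀ y, p (s y) = y := by
  classical
  let N := AddSubmonoid.closure (Set.range x)
  let H := AddSubgroup.closure (Set.range fun i => c.gam (x i))
  have hH : AddGroup.FG H := by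
    refine (AddGroup.fg_iff_addSubgroup_fg H).2 ⟨Finset.univ.image fun i => c.gam (x i), ?_⟩
    simp [H]
  have hNH : ∀ y : N, c.gam y ∈ H := by
    rintro ⟨y, hy⟩
    have : N ≤ H.toAddSubmonoid.comap c.gam := by
      rw [AddSubmonoid.closure_le]
      rintro _ ⟨i, rfl⟩
      exact AddSubgroup.subset_closure ⟨i, rfl⟩
    exact this hy
  let r : N →+ H := (c.gam.comp N.subtype).codRestrict H hNH
  let k : ι → H := fun i => ⟨c.gam (x i), AddSubgroup.subset_closure ⟨i, rfl⟩⟩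
  have hk : AddSubgroup.closure (Set.range k) = ⊤ := by
    have := AddSubgroup.closure_closure_coe_preimage (k := Set.range fun i => c.gam (x i))
    rw [← this]
    congr 1
    ext ⟨h, hh⟩
    simp [k, Subtype.ext_iff]
  have htop : Finset.univ.sup (c.capIdeal x) = ⊤ := by
    refine eq_top_iff.2 (le_trans ?_ (Finset.le_sup (Finset.mem_univ (∅ : Finset ι))))
    simp [capIdeal]
  obtain ⟨l, l1, l2, l3, l4, -⟩ := c.exists_splitting x hH Finset.univ (by simp) H.subtype
    (fun y => by rw [htop, gsub_top]; trivial)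
  obtain ⟨f, f1, f2, f3, f4⟩ := c.exists_idempotents x k hk l l1
  -- Outside the support of y the component `l S` is already zero, so cutting it off there loses
  -- nothing in G and preserves additivity.
  have hvan : ∀ S, ∀ y (hy : y ∈ N), ¬ c.capIdeal x S ≤ c.princ y → l S (r ⟨y, hy⟩) = 0 := by
    intro S y hy
    induction hy using AddSubmonoid.closure_induction with
    | mem _ h =>
      obtain ⟨i, rfl⟩ := h
      intro hn
      exact l3 i _ (c.gam_mem_gsub (c.self_mem_princ _)) S
        fun hi => hn (c.capIdeal_le_princ x hi)
    | zero =>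
      intro _
      exact (congrArg (l S) (map_zero r)).trans (map_zero _)
    | add y z hy hz ihy ihz =>
      intro hn
      rw [princ_add] at hn
      have h1 := ihy fun h => hn (h.trans le_sup_left)
      have h2 := ihz fun h => hn (h.trans le_sup_right)
      have : r ⟨y + z, add_mem hy hz⟩ = r ⟨y, hy⟩ + r ⟨z, hz⟩ := map_add r ⟨y, hy⟩ ⟨z, hz⟩
      rw [this, map_add, h1, h2, add_zero]
  have hcov : ∀ y ∈ N, c.eps y +
      ∑ S ∈ (c.essentials x).filter (fun S => c.capIdeal x S ≤ c.princ y), f S =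
      ∑ S ∈ (c.essentials x).filter (fun S => c.capIdeal x S ≤ c.princ y), f S := by
    have habs : ∀ U V : Finset (Finset ι), U ⊆ V → ∀ e, e + ∑ S ∈ U, f S = ∑ S ∈ U, f S →
        e + ∑ S ∈ V, f S = ∑ S ∈ V, f S := by
      intro U V hUV e he
      rw [← Finset.sum_sdiff hUV, add_comm, add_assoc, add_comm _ e, he]
    intro y hy
    induction hy using AddSubmonoid.closure_induction with
    | mem _ h =>
      obtain ⟨i, rfl⟩ := h
      exact habs _ _ (fun S hS => by
        rw [Finset.mem_filter] at hS ⊢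
        exact ⟨hS.1, c.capIdeal_le_princ x hS.2⟩) _ (f3 i)
    | zero => rw [map_zero, zero_add]
    | add y z hy hz ihy ihz =>
      rw [map_add, add_assoc, habs _ _ (fun S hS => ?_) _ ihz, habs _ _ (fun S hS => ?_) _ ihy]
      all_goals
        rw [Finset.mem_filter] at hS ⊢
        rw [princ_add]
      · exact ⟨hS.1, hS.2.trans le_sup_left⟩
      · exact ⟨hS.1, hS.2.trans le_sup_right⟩
  choose ψ hψe hψg using f4
  let T := {S // S ∈ c.essentials x}
  have hT : ∀ t : T, c.Essential x t.1 := fun t => (c.mem_essentials x).1 t.2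
  let K : T → Type u := fun t => (l t.1).range
  have hK : ∀ t (a : K t), ∃ z, c.eps z = f t.1 ∧ c.gam z = a.1 := by
    rintro t ⟨_, y, rfl⟩
    exact ⟨ψ t.1 y, hψe _ _, hψg _ _⟩
  choose θ hθe hθg using hK
  let Θ : ∀ t, WithZero (K t) →+ M := fun t => WithZero.lift
    { toFun := θ t
      map_add' := fun a b => c.inj _ _
        (by rw [map_add, hθe, hθe, hθe, ← f2, c.eps_add_eps])
        (by rw [map_add, hθg, hθg, hθg]; rfl) }
  let s : N →+ ∀ t, WithZero (K t) :=
    { toFun := fun y t => if c.capIdeal x t.1 ≤ c.princ y.1 then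
        (((l t.1).rangeRestrict (r y) : K t) : WithZero (K t)) else 0
      map_zero' := by
        ext1 t
        exact if_neg (Essential.not_le_princ_zero c (hT t))
      map_add' := fun y z => by
        ext1 t
        have hyz : c.princ (y + z).1 = c.princ y.1 ⊔ c.princ z.1 := c.princ_add _ _
        have h0 : ∀ y : N, ¬ c.capIdeal x t.1 ≤ c.princ y.1 →
            (l t.1).rangeRestrict (r y) = 0 := fun y hy => Subtype.ext (hvan t.1 y.1 y.2 hy)
        rw [Pi.add_apply]
        by_cases h1 : c.capIdeal x t.1 ≤ c.princ y.1
        · have h3 : c.capIdeal x t.1 ≤ c.princ (y + z).1 := by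
            rw [hyz]; exact h1.trans le_sup_left
          rw [if_pos h1, if_pos h3, map_add, map_add]
          by_cases h2 : c.capIdeal x t.1 ≤ c.princ z.1
          · rw [if_pos h2]; rfl
          · rw [if_neg h2, h0 z h2, add_zero, add_zero]
        · rw [if_neg h1, zero_add]
          by_cases h2 : c.capIdeal x t.1 ≤ c.princ z.1
          · have h3 : c.capIdeal x t.1 ≤ c.princ (y + z).1 := by
              rw [hyz]; exact h2.trans le_sup_right
            rw [if_pos h2, if_pos h3, map_add, map_add, h0 y h1, zero_add]
          · rw [if_neg h2, if_neg]
            exact fun h => (Essential.le_or_le c (hT t) y.2 z.2 h).elim h1 h2 }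
  let p : (∀ t, WithZero (K t)) →+ M := ∑ t, (Θ t).comp (Pi.evalAddMonoidHom _ t)
  refine ⟨T, inferInstance, K, fun t => inferInstance, fun t => ?_, s, p, fun y => ?_⟩
  · exact @AddGroup.fg_range _ _ _ _ hH (l t.1)
  · have hp : p (s y) = ∑ t : T, Θ t (s y t) := by simp [p]
    have hsy : ∀ t : T, s y t = if c.capIdeal x t.1 ≤ c.princ y.1 then
        (((l t.1).rangeRestrict (r y) : K t) : WithZero (K t)) else 0 := fun t => rfl
    have hΘe : ∀ t : T, c.eps (Θ t (s y t)) =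
        if c.capIdeal x t.1 ≤ c.princ y.1 then f t.1 else 0 := by
      intro t
      rw [hsy]
      split_ifs
      · exact hθe t _
      · rw [map_zero, map_zero]
    have hΘg : ∀ t : T, c.gam (Θ t (s y t)) = l t.1 (r y) := by
      intro t
      rw [hsy]
      split_ifs with h
      · exact hθg t _
      · rw [map_zero, map_zero, hvan t.1 y.1 y.2 h]
    rw [hp]
    -- Idempotent parts: `hcov` gives one inequality, and the other holds because each `f S` in the
    -- sum lies in the ideal of y. Group parts: the components `l S` add up to the inclusion, and
    -- inessential ones vanish.
    apply c.inj
    · rw [map_sum, Finset.sum_congr rfl fun t _ => hΘe t,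
        Finset.sum_coe_sort (c.essentials x)
          (fun S => if c.capIdeal x S ≤ c.princ y.1 then f S else 0), ← Finset.sum_filter,
        ← hcov y.1 y.2, add_comm]
      have hmem : ∑ S ∈ (c.essentials x).filter (fun S => c.capIdeal x S ≤ c.princ y.1), f S ∈
          c.princ y.1 := sum_mem fun S hS => (Finset.mem_filter.1 hS).2 (f1 S)
      rw [mem_princ, map_sum, Finset.sum_congr rfl fun S _ => f2 S] at hmem
      exact hmem
    · rw [map_sum, Finset.sum_congr rfl fun t _ => hΘg t,
        Finset.sum_coe_sort (c.essentials x) (fun S => l S (r y)),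
        Finset.sum_subset (Finset.subset_univ _) fun S _ hS => ?_]
      · exact (l2 (r y)).symm
      · rw [l4 S (fun h => hS ((c.mem_essentials x).2 h)), AddMonoidHom.zero_apply]

end Coord

/-! ### Reduction to cyclic groups. -/

/-- A homomorphism from `K ⊔ {0}`, with `K` a finitely generated abelian group, factors through
a finite direct sum of blocks. -/
theorem exists_factor_cyclic {K M : Type u} [AddCommGroup K] [AddCommMonoid M]
    (hK : AddGroup.FG K) (ψ : WithZero K →+ M) :
    ∃ (σ : Type) (_ : Fintype σ) (n : σ → ℕ) (s : WithZero K →+ ∀ i, WithZero (ZMod (n i)))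
      (p : (∀ i, WithZero (ZMod (n i))) →+ M), ∀ k, p (s k) = ψ k := by
  classical
  obtain ⟨σ, _, n, ⟨e⟩⟩ := exists_addEquiv_pi_zmod K hK
  let t : ∀ j, WithZero (ZMod (n j)) →+ M := fun j => WithZero.lift
    { toFun := fun z => ψ ((e.symm (Pi.single j z) : K) : WithZero K)
      map_add' := fun a b => by
        rw [Pi.single_add, map_add, WithZero.coe_add, map_add] }
  -- An extra trivial group records the idempotent `ψ 0`; without it nothing would distinguish the
  -- neutral element of K from the adjoined zero when K has no cyclic summands.
  let t0 : WithZero (ZMod 1) →+ M := WithZero.lift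
    { toFun := fun _ => ψ ((0 : K) : WithZero K)
      map_add' := fun a b => by rw [← map_add, ← WithZero.coe_add, add_zero] }
  let n' : Option σ → ℕ := fun o => o.elim 1 n
  let s : WithZero K →+ ∀ i, WithZero (ZMod (n' i)) := WithZero.lift
    { toFun := fun k i => match i with
        | none => ((0 : ZMod 1) : WithZero (ZMod 1))
        | some j => ((e k j : ZMod (n j)) : WithZero (ZMod (n j)))
      map_add' := fun a b => by
        ext1 i
        cases i with
        | none => rfl
        | some j =>
          change ((e (a + b) j : ZMod (n j)) : WithZero (ZMod (n j))) = _
          rw [map_add]; rfl }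
  let p : (∀ i, WithZero (ZMod (n' i))) →+ M :=
    t0.comp (Pi.evalAddMonoidHom (fun i => WithZero (ZMod (n' i))) none) +
      ∑ j, (t j).comp (Pi.evalAddMonoidHom (fun i => WithZero (ZMod (n' i))) (some j))
  have hp : ∀ v, p v = t0 (v none) + ∑ j, t j (v (some j)) := fun v => by
    change t0 (v none) + (∑ j, _ : _ →+ M) v = _
    rw [AddMonoidHom.finsetSum_apply]
    rfl
  have hsum : ∀ (U : Finset σ) (a : σ → K), ψ ((0 : K) : WithZero K) +
      ∑ j ∈ U, ψ ((a j : K) : WithZero K) = ψ ((∑ j ∈ U, a j : K) : WithZero K) := by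
    intro U a
    induction U using Finset.induction_on with
    | empty => simp
    | insert j U hj ih =>
      rw [Finset.sum_insert hj, Finset.sum_insert hj, add_left_comm, ih, ← map_add,
        WithZero.coe_add]
  refine ⟨Option σ, inferInstance, n', s, p, fun k => ?_⟩
  refine WithZero.cases_on k (by rw [map_zero, map_zero, map_zero]) fun k => ?_
  rw [hp]
  change ψ ((0 : K) : WithZero K) + ∑ j, ψ ((e.symm (Pi.single j (e k j)) : K) : WithZero K) = _
  rw [hsum, ← map_sum, Finset.univ_sum_single, e.symm_apply_apply]

/-- The inclusion of a finitely generated submonoid factors through a finite direct sum of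
blocks. -/
theorem Coord.exists_factor {M G : Type u} [AddCommMonoid M] [AddCommGroup G] (c : Coord M G)
    (F : Finset M) : ∃ (σ : Type) (_ : Fintype σ) (n : σ → ℕ)
    (s : AddSubmonoid.closure (F : Set M) →+ ∀ i, WithZero (ZMod (n i)))
    (p : (∀ i, WithZero (ZMod (n i))) →+ M), ∀ y, p (s y) = y := by
  classical
  let x : Fin F.card → M := fun i => F.equivFin.symm i
  have hx : Set.range x = F := by
    ext y
    simp only [x, Set.mem_range, SetLike.mem_coe]
    constructor
    · rintro ⟨i, rfl⟩; exact (F.equivFin.symm i).2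
    · intro hy; exact ⟨F.equivFin ⟨y, hy⟩, by simp⟩
  have hfac := c.exists_factor_groups x
  rw [hx] at hfac
  obtain ⟨T, _, K, _, hK, s, p, hsp⟩ := hfac
  choose σ hσ n s' p' hp' using fun t => exists_factor_cyclic (hK t)
    (p.comp (AddMonoidHom.single (fun t => WithZero (K t)) t))
  refine ⟨Σ t, σ t, inferInstance, fun a => n a.1 a.2,
    { toFun := fun y a => s' a.1 (s y a.1) a.2
      map_zero' := by ext1 a; simp
      map_add' := fun y z => by ext1 a; simp },
    ∑ t, (p' t).comp
      { toFun := fun v i => v ⟨t, i⟩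
        map_zero' := rfl
        map_add' := fun _ _ => rfl }, fun y => ?_⟩
  rw [← hsp y]
  simp only [AddMonoidHom.finsetSum_apply, AddMonoidHom.comp_apply]
  change ∑ t, p' t (s' t (s y t)) = _
  simp only [hp', AddMonoidHom.comp_apply]
  rw [← map_sum]
  congr 1
  exact Finset.univ_sum_single (s y)

/-- The block is generated by 1 and -1: the neutral element of the group, distinct from the adjoined
zero, is 1 + (-1). -/
theorem block_apply_mem {n : ℕ} {M : Type*} [AddCommMonoid M] (q : WithZero (ZMod n) →+ M)
    {N : AddSubmonoid M} (h1 : q ((1 : ZMod n) : WithZero (ZMod n)) ∈ N)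
    (h2 : q ((-1 : ZMod n) : WithZero (ZMod n)) ∈ N) (z : WithZero (ZMod n)) : q z ∈ N := by
  refine WithZero.cases_on z (by rw [map_zero]; exact zero_mem _) fun z => ?_
  obtain ⟨m, rfl⟩ := ZMod.intCast_surjective z
  induction m using Int.induction_on with
  | zero =>
    have : (((0 : ℤ) : ZMod n) : WithZero (ZMod n)) =
        ((1 : ZMod n) : WithZero (ZMod n)) + ((-1 : ZMod n) : WithZero (ZMod n)) := by
      rw [← WithZero.coe_add, add_neg_cancel, Int.cast_zero]
    rw [this, map_add]
    exact add_mem h1 h2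
  | succ i ih =>
    rw [Int.cast_add, Int.cast_one, WithZero.coe_add, map_add]
    exact add_mem ih h1
  | pred i ih =>
    rw [Int.cast_sub, Int.cast_one, sub_eq_add_neg, WithZero.coe_add, map_add]
    exact add_mem ih h2

theorem exists_finset_range_le {σ : Type} [Fintype σ] {n : σ → ℕ} {M : Type*} [AddCommMonoid M]
    (p : (∀ i, WithZero (ZMod (n i))) →+ M) :
    ∃ R : Finset M, ∀ a, p a ∈ AddSubmonoid.closure (R : Set M) := by
  classical
  let q : ∀ i, WithZero (ZMod (n i)) →+ M := fun i =>
    p.comp (AddMonoidHom.single (fun i => WithZero (ZMod (n i))) i)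
  refine ⟨Finset.univ.image (fun i => q i ((1 : ZMod (n i)) : WithZero (ZMod (n i)))) ∪
    Finset.univ.image (fun i => q i ((-1 : ZMod (n i)) : WithZero (ZMod (n i)))), fun a => ?_⟩
  rw [← Finset.univ_sum_single a, map_sum]
  refine sum_mem fun i _ => block_apply_mem (q i) ?_ ?_ (a i)
  · exact AddSubmonoid.subset_closure (by simp)
  · exact AddSubmonoid.subset_closure (by simp)

/-- `ZMod 0` is ℤ, so one family covers both kinds of block. -/
theorem isBlock_withZero_zmod (n : ℕ) : IsBlock (WithZero (ZMod n)) := by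
  rcases Nat.eq_zero_or_pos n with rfl | h
  · exact Or.inr ⟨AddEquiv.refl (WithZero ℤ)⟩
  · exact Or.inl ⟨n, h, ⟨AddEquiv.refl _⟩⟩

theorem isFiniteSumOfBlocks_pi {A : Type u} [AddCommMonoid A] {σ : Type} [Fintype σ] {n : σ → ℕ}
    (e : A ≃+ ∀ i, WithZero (ZMod (n i))) : IsFiniteSumOfBlocks A :=
  let r := Fintype.equivFin σ
  ⟨Fintype.card σ, fun i => WithZero (ZMod (n (r.symm i))), fun _ => inferInstance,
    fun _ => isBlock_withZero_zmod _,
    ⟨e.trans { Equiv.piCongrLeft' (fun i => WithZero (ZMod (n i))) r with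
      map_add' := fun _ _ => rfl }⟩⟩

/-! ### Assembling factorizations into a direct limit. -/

/-- A finite subset together with a level; the indices of the direct limit below. -/
structure Stage (M : Type u) where
  level : ℕ
  gens : Finset M

/-- If every finitely generated submonoid of `M` factors through a finite direct sum of blocks,
then `M` is a direct limit of such sums. The limit is indexed by the finite subsets of `M`
together with a level that makes the transition maps pass through `M`. -/
theorem isDirectLimit_of_factor (M : Type u) [AddCommMonoid M]
    (h : ∀ F : Finset M, ∃ (A : Type u) (_ : AddCommMonoid A)
      (s : AddSubmonoid.closure (F : Set M) →+ A) (p : A →+ M), IsFiniteSumOfBlocks A ∧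
      (∃ R : Finset M, ∀ a, p a ∈ AddSubmonoid.closure (R : Set M)) ∧ ∀ y, p (s y) = y) :
    IsDirectLimitOfFiniteSumsOfBlocks M := by
  classical
  choose A hA s p hsum hR hsp using h
  -- The strict increase of level gives antisymmetry. The diagonal is kept apart because going
  -- through M and back need not be the identity of a stage.
  let le : Stage M → Stage M → Prop := fun i j =>
    i = j ∨ (i.1 < j.1 ∧ ∀ a, p i.2 a ∈ AddSubmonoid.closure (j.2 : Set M))
  have hsub : ∀ F : Finset M, ∀ y ∈ AddSubmonoid.closure (F : Set M), ∃ a, p F a = y :=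
    fun F y hy => ⟨s F ⟨y, hy⟩, hsp F ⟨y, hy⟩⟩
  let P : PartialOrder (Stage M) :=
    { le := le
      le_refl := fun i => Or.inl rfl
      le_trans := by
        rintro i j k (rfl | ⟨h1, h2⟩) (rfl | ⟨h3, h4⟩)
        · exact Or.inl rfl
        · exact Or.inr ⟨h3, h4⟩
        · exact Or.inr ⟨h1, h2⟩
        · refine Or.inr ⟨h1.trans h3, fun a => ?_⟩
          obtain ⟨b, hb⟩ := hsub _ _ (h2 a)
          exact hb ▸ h4 b
      le_antisymm := by
        rintro i j (rfl | ⟨h1, h2⟩) (h | ⟨h3, h4⟩)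
        · rfl
        · rfl
        · exact h.symm
        · exact absurd (h1.trans h3) (lt_irrefl _) }
  have hub : ∀ i j : Stage M, ∃ k : Stage M, i ≠ k ∧ P.le i k ∧ P.le j k := by
    intro i j
    obtain ⟨R, hR1⟩ := hR i.2
    obtain ⟨R', hR2⟩ := hR j.2
    refine ⟨⟨max i.1 j.1 + 1, R ∪ R'⟩, fun h => ?_, Or.inr ⟨?_, fun a => ?_⟩,
      Or.inr ⟨?_, fun a => ?_⟩⟩
    · have := congrArg Stage.level h
      dsimp only at this
      have := le_max_left i.1 j.1
      omega
    · exact Nat.lt_succ_of_le (le_max_left _ _)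
    · exact AddSubmonoid.closure_mono (by simp) (hR1 a)
    · exact Nat.lt_succ_of_le (le_max_right _ _)
    · exact AddSubmonoid.closure_mono (by simp) (hR2 a)
  let D : @IsDirectedOrder (Stage M) P.toLE :=
    ⟨fun i j => by
      obtain ⟨k, -, h1, h2⟩ := hub i j
      exact ⟨k, h1, h2⟩⟩
  let B : Stage M → Type u := fun i => A i.2
  let f : ∀ i j : Stage M, P.le i j → B i →+ B j := fun i j h =>
    if hij : i = j then hij ▸ AddMonoidHom.id (B i)
    else (s j.2).comp ((p i.2).codRestrict _ (h.resolve_left hij).2)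
  have f_self : ∀ i (h : P.le i i) x, f i i h x = x := by
    intro i h x
    exact congrArg (fun g : B i →+ B i => g x) (dif_pos rfl)
  have f_ne : ∀ i j (h : P.le i j) (hij : i ≠ j) x,
      f i j h x = s j.2 ⟨p i.2 x, (h.resolve_left hij).2 x⟩ := by
    intro i j h hij x
    exact congrArg (fun g : B i →+ B j => g x) (dif_neg hij)
  have pf : ∀ i j (h : P.le i j) x, p j.2 (f i j h x) = p i.2 x := by
    intro i j h x
    by_cases hij : i = j
    · subst hij
      exact congrArg (p i.gens) (f_self i h x)
    · rw [f_ne i j h hij, hsp]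
  -- A transition between distinct stages depends only on the value in M. This yields compatibility
  -- of the system and injectivity of the map from the limit.
  have f_ext : ∀ i j (h : P.le i j) (hij : i ≠ j) x k (h' : P.le k j) (hkj : k ≠ j) y,
      p i.2 x = p k.2 y → f i j h x = f k j h' y := by
    intro i j h hij x k h' hkj y hxy
    rw [f_ne i j h hij, f_ne k j h' hkj]
    congr 1
    exact Subtype.ext hxy
  let S : @DirectedSystem _ P.toPreorder B (fun i j h => f i j h) :=
    { map_self := fun i x => f_self i (P.le_refl i) x
      map_map := by
        intro k j i hij hjk x
        by_cases h1 : i = j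
        · subst h1
          exact congrArg (f i k hjk) (f_self i hij x)
        by_cases h2 : j = k
        · subst h2
          exact f_self j hjk _
        have h3 : i ≠ k := by
          rintro rfl
          exact h1 (P.le_antisymm _ _ hij hjk)
        exact f_ext j k hjk h2 _ i (P.le_trans _ _ _ hij hjk) h3 x (pf i j hij x) }
  refine ⟨Stage M, P, D, ⟨⟨0, ∅⟩⟩, B, fun i => hA i.2, f, S, fun i => hsum i.2, ?_⟩
  have : Nonempty (Stage M) := ⟨⟨0, ∅⟩⟩
  let Φ : DirectLimit B f →+ M :=
    { toFun := DirectLimit.lift f (fun i x => p i.2 x) fun i j h x => (pf i j h x).symm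
      map_zero' := DirectLimit.lift_zero (f := f) (fun i => p i.2) _
      map_add' := fun x y => DirectLimit.lift_add (f := f) (fun i => p i.2) _ x y }
  refine ⟨(AddEquiv.ofBijective Φ ⟨fun x y hxy => ?_, fun y => ?_⟩).symm⟩
  · obtain ⟨i, a, b, rfl, rfl⟩ := DirectLimit.exists_eq_mk₂ f x y
    replace hxy : p i.2 a = p i.2 b := hxy
    obtain ⟨k, hk, hik, -⟩ := hub i i
    exact Quotient.sound ⟨k, hik, hik, f_ext i k hik hk a i hik hk b hxy⟩
  · obtain ⟨a, ha⟩ := hsub {y} y (AddSubmonoid.subset_closure (by simp))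
    exact ⟨⟦⟨⟨0, {y}⟩, a⟩⟧, ha⟩

theorem Coord.isDirectLimit {M G : Type u} [AddCommMonoid M] [AddCommGroup G] (c : Coord M G) :
    IsDirectLimitOfFiniteSumsOfBlocks M := by
  refine isDirectLimit_of_factor M fun F => ?_
  obtain ⟨σ, _, n, s, p, hsp⟩ := c.exists_factor F
  obtain ⟨R, hR⟩ := exists_finset_range_le p
  let e : ULift.{u} (∀ i, WithZero (ZMod (n i))) ≃+ ∀ i, WithZero (ZMod (n i)) := AddEquiv.ulift
  exact ⟨ULift.{u} (∀ i, WithZero (ZMod (n i))), inferInstance, e.symm.toAddMonoidHom.comp s,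
    p.comp e.toAddMonoidHom, isFiniteSumOfBlocks_pi e, ⟨R, fun a => hR _⟩, fun y => hsp y⟩

/-! ### Necessity of the conditions. -/

/-- The defining conditions as statements about finitely many elements and equations, a form
that passes to products and direct limits. -/
structure ElementaryConditions (M : Type*) [AddCommMonoid M] : Prop where
  regular : ∀ x : M, ∃ z, x + x + z = x
  conical : ∀ x y : M, x + y = 0 → x = 0
  refinement : ∀ a b c d : M, a + b = c + d →
    ∃ p q r s : M, a = p + q ∧ b = r + s ∧ c = p + r ∧ d = q + s
  emb : ∀ x y z u v : M, x + u = y → y + v = x → x + z = y + z → x = y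
  pur : ∀ (n : ℕ) (y x b : M), n ≠ 0 → b + b = b → n • y = x + b →
    ∃ h u v, h + u = x ∧ x + v = h ∧ n • h + b = n • y

namespace ElementaryConditions

theorem of_addEquiv {M N : Type*} [AddCommMonoid M] [AddCommMonoid N] (e : M ≃+ N)
    (h : ElementaryConditions N) : ElementaryConditions M where
  regular x := by
    obtain ⟨z, hz⟩ := h.regular (e x)
    exact ⟨e.symm z, e.injective (by simpa using hz)⟩
  conical x y hxy := e.injective (by
    rw [map_zero]
    exact h.conical (e x) (e y) (by rw [← map_add, hxy, map_zero]))
  refinement a b c d hab := by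
    obtain ⟨p, q, r, s, h1, h2, h3, h4⟩ := h.refinement (e a) (e b) (e c) (e d)
      (by rw [← map_add, hab, map_add])
    refine ⟨e.symm p, e.symm q, e.symm r, e.symm s, ?_, ?_, ?_, ?_⟩ <;>
      apply e.injective <;> simpa
  emb x y z u v h1 h2 h3 := e.injective
    (h.emb (e x) (e y) (e z) (e u) (e v) (by rw [← map_add, h1]) (by rw [← map_add, h2])
      (by rw [← map_add, h3, map_add]))
  pur n y x b hn hb hy := by
    obtain ⟨k, u, v, h1, h2, h3⟩ := h.pur n (e y) (e x) (e b) hn (by rw [← map_add, hb])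
      (by rw [← map_nsmul, hy, map_add])
    refine ⟨e.symm k, e.symm u, e.symm v, ?_, ?_, ?_⟩ <;> apply e.injective <;> simpa

theorem pi {ι : Type*} {B : ι → Type*} [∀ i, AddCommMonoid (B i)]
    (h : ∀ i, ElementaryConditions (B i)) : ElementaryConditions (∀ i, B i) where
  regular x := by
    choose z hz using fun i => (h i).regular (x i)
    exact ⟨z, funext hz⟩
  conical x y hxy := funext fun i => (h i).conical (x i) (y i) (congrFun hxy i)
  refinement a b c d hab := by
    choose p q r s h1 h2 h3 h4 using fun i =>
      (h i).refinement (a i) (b i) (c i) (d i) (congrFun hab i)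
    exact ⟨p, q, r, s, funext h1, funext h2, funext h3, funext h4⟩
  emb x y z u v h1 h2 h3 := funext fun i =>
    (h i).emb (x i) (y i) (z i) (u i) (v i) (congrFun h1 i) (congrFun h2 i) (congrFun h3 i)
  pur n y x b hn hb hy := by
    choose k u v h1 h2 h3 using fun i =>
      (h i).pur n (y i) (x i) (b i) hn (congrFun hb i) (congrFun hy i)
    exact ⟨k, u, v, funext h1, funext h2, funext h3⟩

theorem withZero (G : Type*) [AddCommGroup G] : ElementaryConditions (WithZero G) where
  regular x := by
    refine WithZero.cases_on x ⟨0, by simp⟩ fun x => ⟨((-x : G) : WithZero G), ?_⟩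
    rw [← WithZero.coe_add, ← WithZero.coe_add, add_neg_cancel_right]
  conical x y := by
    refine WithZero.cases_on x (fun _ => rfl) fun x => ?_
    refine WithZero.cases_on y (fun h => ?_) fun y h => ?_
    · rwa [add_zero] at h
    · rw [← WithZero.coe_add] at h
      exact absurd h WithZero.coe_ne_zero
  refinement a b c d := by
    refine WithZero.cases_on a (fun h => ⟨0, 0, c, d, by simp, by simpa using h, by simp, by simp⟩)
      fun a => ?_
    refine WithZero.cases_on b (fun h => ⟨c, d, 0, 0, by simpa using h, by simp, by simp, by simp⟩)
      fun b => ?_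
    refine WithZero.cases_on c (fun h => ⟨0, a, 0, b, by simp, by simp, by simp, ?_⟩)
      fun c => ?_
    · rw [h, zero_add]
    refine WithZero.cases_on d (fun h => ⟨a, 0, b, 0, by simp, by simp, ?_, by simp⟩)
      fun d h => ?_
    · rw [h, add_zero]
    rw [← WithZero.coe_add, ← WithZero.coe_add, WithZero.coe_inj] at h
    -- The zero entry is the neutral element of G, not the adjoined one.
    refine ⟨(a : G), ((0 : G) : WithZero G), ((c - a : G) : WithZero G), (d : G), ?_, ?_, ?_, ?_⟩ <;>
      rw [← WithZero.coe_add, WithZero.coe_inj]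
    · rw [add_zero]
    · rw [sub_add_eq_add_sub, ← h, add_sub_cancel_left]
    · rw [add_sub_cancel]
    · rw [zero_add]
  -- Mutually comparable elements are both the adjoined zero or both in G, where cancellation holds.
  emb x y z u v := by
    refine WithZero.cases_on x (fun _ h2 _ => ?_) fun x => ?_
    · refine (WithZero.cases_on y (fun _ => rfl) (fun y h => ?_) : y + v = 0 → 0 = y) h2
      refine (WithZero.cases_on v (fun h => ?_) (fun v h => ?_) :
        (y : WithZero G) + v = 0 → 0 = (y : WithZero G)) h
      · rw [add_zero] at h; exact h.symm
      · rw [← WithZero.coe_add] at h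
        exact absurd h WithZero.coe_ne_zero
    · refine WithZero.cases_on y (fun h1 _ _ => ?_) fun y _ _ => ?_
      · refine (WithZero.cases_on u (fun h => by rwa [add_zero] at h) (fun u h => ?_) :
          (x : WithZero G) + u = 0 → (x : WithZero G) = 0) h1
        rw [← WithZero.coe_add] at h
        exact absurd h WithZero.coe_ne_zero
      · refine WithZero.cases_on z (fun h => by simpa using h) fun z h => ?_
        rw [← WithZero.coe_add, ← WithZero.coe_add, WithZero.coe_inj] at h
        rw [add_right_cancel h]
  pur n y x b hn hb := by
    refine WithZero.cases_on x (fun h => ⟨0, 0, 0, by simp, by simp, by simpa using h.symm⟩)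
      fun x => ?_
    refine WithZero.cases_on y (fun h => ?_) fun y h => ?_
    · rw [smul_zero] at h
      revert h
      refine WithZero.cases_on b (fun h => ?_) fun b h => ?_
      · rw [add_zero] at h; exact absurd h.symm WithZero.coe_ne_zero
      · rw [← WithZero.coe_add] at h; exact absurd h.symm WithZero.coe_ne_zero
    -- Any two elements of G are comparable, so y itself serves; b is absorbed because n • y already
    -- has b as a summand.
    · refine ⟨y, ((x - y : G) : WithZero G), ((y - x : G) : WithZero G), ?_, ?_, ?_⟩
      · rw [← WithZero.coe_add, add_sub_cancel]
      · rw [← WithZero.coe_add, add_sub_cancel]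
      · rw [h, add_assoc, hb]

theorem of_isBlock {M : Type*} [AddCommMonoid M] (h : IsBlock M) : ElementaryConditions M := by
  rcases h with ⟨n, _, ⟨e⟩⟩ | h
  · exact of_addEquiv e (withZero _)
  · exact of_addEquiv h.some (withZero _)

theorem of_isFiniteSumOfBlocks {M : Type*} [AddCommMonoid M] (h : IsFiniteSumOfBlocks M) :
    ElementaryConditions M := by
  obtain ⟨k, B, _, hB, ⟨e⟩⟩ := h
  exact of_addEquiv e (pi fun i => of_isBlock (hB i))

section Limit

variable {ι : Type*} [PartialOrder ι] [IsDirectedOrder ι] [Nonempty ι] {A : ι → Type*}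
  [∀ i, AddCommMonoid (A i)] (f : ∀ i j : ι, i ≤ j → A i →+ A j) [DirectedSystem A (f · · ·)]

/-- The canonical map from a stage to the direct limit. -/
def toLimit (i : ι) : A i →+ DirectLimit A f where
  toFun x := ⟦⟨i, x⟩⟧
  map_zero' := (DirectLimit.zero_def i).symm
  map_add' x y := (DirectLimit.add_def i x y).symm

theorem toLimit_map {i j : ι} (h : i ≤ j) (x : A i) : toLimit f j (f i j h x) = toLimit f i x :=
  DirectLimit.mk_apply i j x h

theorem exists_map_eq {ν : Type*} [Finite ν] {i : ι} (x y : ν → A i)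
    (h : ∀ e, toLimit f i (x e) = toLimit f i (y e)) :
    ∃ j, ∃ hij : i ≤ j, ∀ e, f i j hij (x e) = f i j hij (y e) := by
  choose j h1 _ h2 using fun e => Quotient.exact (h e)
  obtain ⟨k, hk⟩ := Finite.exists_le j
  obtain ⟨m, him, hkm⟩ := exists_ge_ge i k
  refine ⟨m, him, fun e => ?_⟩
  have h3 := congrArg (f _ _ ((hk e).trans hkm)) (h2 e)
  rwa [DirectedSystem.map_map' f, DirectedSystem.map_map' f] at h3

theorem exists_toLimit {κ : Type*} [Finite κ] (x : κ → DirectLimit A f) :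
    ∃ (i : ι) (a : κ → A i), ∀ k, toLimit f i (a k) = x k := by
  choose i a ha using fun k => DirectLimit.exists_eq_mk f (x k)
  obtain ⟨j, hj⟩ := Finite.exists_le i
  exact ⟨j, fun k => f _ _ (hj k) (a k), fun k => (toLimit_map f _ _).trans (ha k).symm⟩

/-- Finitely many elements live at one stage, and finitely many equations between them hold at a
later one. The solutions found there map to the limit. -/
theorem directLimit (h : ∀ i, ElementaryConditions (A i)) :
    ElementaryConditions (DirectLimit A f) where
  regular x := by
    obtain ⟨i, a, ha⟩ := exists_toLimit f ![x]
    obtain rfl : _ = x := ha 0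
    obtain ⟨z, hz⟩ := (h i).regular (a 0)
    exact ⟨toLimit f i z, by rw [← map_add, ← map_add, hz]⟩
  conical x y hxy := by
    obtain ⟨i, a, ha⟩ := exists_toLimit f ![x, y]
    obtain ⟨rfl, rfl⟩ : _ = x ∧ _ = y := ⟨ha 0, ha 1⟩
    obtain ⟨j, hij, hj⟩ := exists_map_eq f (fun _ : Unit => a 0 + a 1) (fun _ => 0) (fun _ => by
      rw [map_add, map_zero]
      exact hxy)
    have h1 := hj ()
    rw [map_add, map_zero] at h1
    rw [← toLimit_map f hij, (h j).conical _ _ h1, map_zero]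
  refinement x y z w hxy := by
    obtain ⟨i, a, ha⟩ := exists_toLimit f ![x, y, z, w]
    obtain ⟨rfl, rfl, rfl, rfl⟩ : _ = x ∧ _ = y ∧ _ = z ∧ _ = w := ⟨ha 0, ha 1, ha 2, ha 3⟩
    obtain ⟨j, hij, hj⟩ := exists_map_eq f (fun _ : Unit => a 0 + a 1) (fun _ => a 2 + a 3)
      (fun _ => by
        rw [map_add, map_add]
        exact hxy)
    have h1 := hj ()
    rw [map_add, map_add] at h1
    obtain ⟨p, q, r, s, h2, h3, h4, h5⟩ := (h j).refinement _ _ _ _ h1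
    refine ⟨toLimit f j p, toLimit f j q, toLimit f j r, toLimit f j s, ?_, ?_, ?_, ?_⟩ <;>
      rw [← toLimit_map f hij, ← map_add]
    exacts [congrArg _ h2, congrArg _ h3, congrArg _ h4, congrArg _ h5]
  emb x y z u v h1 h2 h3 := by
    obtain ⟨i, a, ha⟩ := exists_toLimit f ![x, y, z, u, v]
    obtain ⟨rfl, rfl, rfl, rfl, rfl⟩ : _ = x ∧ _ = y ∧ _ = z ∧ _ = u ∧ _ = v :=
      ⟨ha 0, ha 1, ha 2, ha 3, ha 4⟩
    obtain ⟨j, hij, hj⟩ := exists_map_eq f ![a 0 + a 3, a 1 + a 4, a 0 + a 2]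
      ![a 1, a 0, a 1 + a 2] (fun e => by
        fin_cases e
        · exact (map_add _ _ _).trans h1
        · exact (map_add _ _ _).trans h2
        · exact (map_add _ _ _).trans (h3.trans (map_add _ _ _).symm))
    have k1 := (map_add _ _ _).symm.trans (hj 0)
    have k2 := (map_add _ _ _).symm.trans (hj 1)
    have k3 := (map_add _ _ _).symm.trans ((hj 2).trans (map_add _ _ _))
    rw [← toLimit_map f hij, (h j).emb _ _ _ _ _ k1 k2 k3]
    exact toLimit_map f hij (a 1)
  pur n y x b hn hb hy := by
    obtain ⟨i, a, ha⟩ := exists_toLimit f ![y, x, b]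
    obtain ⟨rfl, rfl, rfl⟩ : _ = y ∧ _ = x ∧ _ = b := ⟨ha 0, ha 1, ha 2⟩
    obtain ⟨j, hij, hj⟩ := exists_map_eq f ![a 2 + a 2, n • a 0] ![a 2, a 1 + a 2] (fun e => by
      fin_cases e
      · exact (map_add _ _ _).trans hb
      · exact (map_nsmul _ _ _).trans (hy.trans (map_add _ _ _).symm))
    have k1 := (map_add _ _ _).symm.trans (hj 0)
    have k2 := (map_nsmul _ _ _).symm.trans ((hj 1).trans (map_add _ _ _))
    obtain ⟨k, u, v, h1, h2, h3⟩ := (h j).pur n _ _ _ hn k1 k2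
    refine ⟨toLimit f j k, toLimit f j u, toLimit f j v, ?_, ?_, ?_⟩
    · rw [← map_add, h1, toLimit_map]
    · rw [← toLimit_map f hij, ← map_add, h2]
    · rw [← toLimit_map f hij, ← toLimit_map f hij, ← map_nsmul, ← map_nsmul, ← map_add, h3]

end Limit

section Conditions

variable {M : Type u} [AddCommMonoid M] (h : ElementaryConditions M)
include h

theorem isRegular : IsRegular M := fun x => by
  obtain ⟨z, hz⟩ := h.regular x
  exact ⟨z, by rw [two_nsmul, hz]⟩

theorem isConical : IsConical M := fun x y hxy =>
  ⟨h.conical x y hxy, h.conical y x (by rw [add_comm, hxy])⟩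

theorem isRefinement : IsRefinement M := fun a b hab => by
  obtain ⟨p, q, r, s, h1, h2, h3, h4⟩ := h.refinement _ _ _ _ hab
  refine ⟨![![p, q], ![r, s]], fun i => ?_⟩
  fin_cases i
  · exact ⟨h1, h3⟩
  · exact ⟨h2, h4⟩

theorem embCondition : EmbCondition M := fun a b hab x y hxy => by
  have hv : x.1 + b.1 = y.1 + b.1 := congrArg Subtype.val hxy
  obtain ⟨u, hu⟩ := x.2.2.trans y.2.1
  obtain ⟨v, hv'⟩ := y.2.2.trans x.2.1
  exact GroupAt.ext (h.emb _ _ _ _ _ hu hv' hv)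

theorem purCondition : PurCondition M := by
  rintro a b hab n y ⟨x, hx⟩
  rcases eq_or_ne n 0 with rfl | hn
  · exact ⟨0, zero_mem _, by rw [zero_nsmul, zero_nsmul]⟩
  have hv := congrArg Subtype.val hx
  rw [GroupAt.val_nsmul _ hn] at hv
  change x.1 + b.1 = n • y.1 at hv
  obtain ⟨k, u, v, h1, h2, h3⟩ := h.pur n _ _ _ hn b.add_self hv.symm
  let k' : GroupAt a := ⟨k, x.2.1.trans ⟨v, h2⟩, AlgLE.trans ⟨u, h1⟩ x.2.2⟩
  refine ⟨naturalMap hab k', ⟨k', rfl⟩, ?_⟩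
  rw [← map_nsmul]
  apply GroupAt.ext
  rw [GroupAt.val_nsmul _ hn]
  change (n • k').1 + b.1 = n • y.1
  rw [GroupAt.val_nsmul _ hn]
  exact h3

end Conditions

end ElementaryConditions
end RegMon

theorem theorem6p7 (M : Type*) [AddCommMonoid M] :
    RegMon.IsDirectLimitOfFiniteSumsOfBlocks M ↔
      RegMon.IsRegular M ∧ RegMon.IsConical M ∧ RegMon.IsRefinement M ∧
        RegMon.EmbCondition M ∧ RegMon.PurCondition M := by
  constructor
  · rintro ⟨ι, _, _, _, A, _, f, _, hA, ⟨e⟩⟩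
    have h := RegMon.ElementaryConditions.of_addEquiv e
      (RegMon.ElementaryConditions.directLimit f
        fun i => RegMon.ElementaryConditions.of_isFiniteSumOfBlocks (hA i))
    exact ⟨h.isRegular, h.isConical, h.isRefinement, h.embCondition, h.purCondition⟩
  · rintro ⟨h1, h2, h3, h4, h5⟩
    exact (RegMon.Coord.ofConditions h1 h2 h3 h4 h5).isDirectLimit
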